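/- Let $d\ge 2$ be an integer, let $\nu$ be the centered Gaussian law on $\mathbb R$ with variance $\sigma^2=\frac{d}{d^2-1}$, and let $Q_t$, $t\ge 0$, be the Ornstein–Uhlenbeck semigroup with variance $\sigma^2$ acting on the real space $L^2(\nu)$, that is, $(Q_t g)(a)=\mathbb E\big[g\big(e^{-t}a+\sqrt{1-e^{-2t}}\,Y\big)\big]$ with $Y$ distributed according to $\nu$. For $h\in\mathbb R$ let $\pi_h$ be multiplication by $1_{[h,\infty)}$, let $L_h=\pi_h\,(d\,Q_{\log d})\,\pi_h$, a bounded operator on $L^2(\nu)$, and let $\lambda_h=\|L_h\|_{L^2(\nu)\to L^2(\nu)}$ be its operator norm. For every $h\in\mathbb R$, $\lambda_h$ is a simple eigenvalue of $L_h$ (its eigenspace is one-dimensional), and there exists a unique function $\chi_h:\mathbb R\to[0,\infty)$ with $\|\chi_h\|_{L^2(\nu)}=1$, continuous and positive on $[h,\infty)$, vanishing on $(-\infty,h)$, such that $L_h\chi_h=\lambda_h\chi_h$ in $L^2(\nu)$. In addition, for all integers $k\ge 0$, $$\|\chi_h\|_{L^{q_k}(\nu)}\le (d/\lambda_h)^k,\qquad\text{where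 } q_k=1+d^{2k}.$$ Moreover, the map $h\mapsto\lambda_h$ is a (strictly) decreasing homeomorphism of $\mathbb R$ onto $(0,d)$. -/

import Mathlib

open MeasureTheory ProbabilityTheory
open scoped NNReal ENNReal

noncomputable section

namespace OUTree

/-- The Ornstein-Uhlenbeck semigroup with variance `v`, on functions:
`(Q_t g)(a) = E[g (e^{-t} a + √(1 - e^{-2t}) Y)]`, where `Y` is centered Gaussian of variance `v`. -/
def ouFun (v t : ℝ≥0) (g : ℝ → ℝ) (a : ℝ) : ℝ :=
  ∫ y, g (Real.exp (-t) * a + Real.sqrt (1 - Real.exp (-(2 * t))) * y) ∂(gaussianReal 0 v)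

/-- If `X`, `Y` are independent centered Gaussians of variance `v`, then so is
`e^{-t} X + √(1 - e^{-2t}) Y`. -/
theorem measurePreserving_ou (v t : ℝ≥0) :
    MeasurePreserving
      (fun p : ℝ × ℝ => Real.exp (-t) * p.1 + Real.sqrt (1 - Real.exp (-(2 * t))) * p.2)
      ((gaussianReal 0 v).prod (gaussianReal 0 v)) (gaussianReal 0 v) := by
  refine ⟨by fun_prop, ?_⟩
  set c := Real.exp (-t)
  set s := Real.sqrt (1 - Real.exp (-(2 * t)))
  have hs : c ^ 2 + s ^ 2 = 1 := by
    have h1 : Real.exp (-(2 * t)) ≤ 1 := Real.exp_le_one_iff.2 (by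
      have := t.2
      simp)
    have h2 : c ^ 2 = Real.exp (-(2 * t)) := by
      simp only [c, ← Real.exp_nat_mul]
      congr 1
      push_cast
      ring
    rw [Real.sq_sqrt (by linarith), h2]
    ring
  have h1 : (fun p : ℝ × ℝ => c * p.1 + s * p.2)
      = (fun p : ℝ × ℝ => p.1 + p.2) ∘ Prod.map (fun x => c * x) (fun x => s * x) := rfl
  rw [h1, ← Measure.map_map (by fun_prop) (by fun_prop),
    ← Measure.map_prod_map _ _ (by fun_prop) (by fun_prop),
    gaussianReal_map_const_mul, gaussianReal_map_const_mul]
  change Measure.conv _ _ = _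
  rw [gaussianReal_conv_gaussianReal]
  congr 1
  · simp
  · ext
    push_cast
    rw [← add_mul, hs, one_mul]

/-- Integrating out one variable contracts `L²` norms (probability measures). -/
theorem eLpNorm_integral_prod_le {μ ν : Measure ℝ} [IsProbabilityMeasure μ]
    [IsProbabilityMeasure ν] {F : ℝ × ℝ → ℝ} (hF : MemLp F 2 (μ.prod ν)) :
    eLpNorm (fun a => ∫ y, F (a, y) ∂ν) 2 μ ≤ eLpNorm F 2 (μ.prod ν) := by
  have hsq : ∀ {X : Type} [MeasurableSpace X] (m : Measure X) (f : X → ℝ),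
      eLpNorm f 2 m = (∫⁻ x, ‖f x‖ₑ ^ (2 : ℝ) ∂m) ^ (1 / 2 : ℝ) := by
    intro X _ m f
    rw [eLpNorm_eq_lintegral_rpow_enorm_toReal (by norm_num) (by norm_num)]
    norm_num
  rw [hsq, hsq]
  refine ENNReal.rpow_le_rpow ?_ (by norm_num)
  rw [lintegral_prod _ (hF.1.enorm.pow_const _)]
  refine lintegral_mono_ae ?_
  filter_upwards [hF.1.prodMk_left] with a ha
  calc ‖∫ y, F (a, y) ∂ν‖ₑ ^ (2 : ℝ)
      ≤ (∫⁻ y, ‖F (a, y)‖ₑ ∂ν) ^ (2 : ℝ) :=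
        ENNReal.rpow_le_rpow (enorm_integral_le_lintegral_enorm _) (by norm_num)
    _ = (eLpNorm (fun y => F (a, y)) 1 ν) ^ (2 : ℝ) := by rw [eLpNorm_one_eq_lintegral_enorm]
    _ ≤ (eLpNorm (fun y => F (a, y)) 2 ν) ^ (2 : ℝ) :=
        ENNReal.rpow_le_rpow (eLpNorm_le_eLpNorm_of_exponent_le (by norm_num) ha) (by norm_num)
    _ = ∫⁻ y, ‖F (a, y)‖ₑ ^ (2 : ℝ) ∂ν := by
        rw [hsq, ← ENNReal.rpow_mul]
        norm_num

theorem eLpNorm_ouFun_le (v t : ℝ≥0) {g : ℝ → ℝ} (hg : MemLp g 2 (gaussianReal 0 v)) :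
    eLpNorm (ouFun v t g) 2 (gaussianReal 0 v) ≤ eLpNorm g 2 (gaussianReal 0 v) := by
  have hφ := measurePreserving_ou v t
  exact (eLpNorm_integral_prod_le (hg.comp_measurePreserving hφ)).trans_eq
    (eLpNorm_comp_measurePreserving hg.1 hφ)

theorem memLp_ouFun (v t : ℝ≥0) {g : ℝ → ℝ} (hg : MemLp g 2 (gaussianReal 0 v)) :
    MemLp (ouFun v t g) 2 (gaussianReal 0 v) :=
  ⟨((hg.comp_measurePreserving (measurePreserving_ou v t)).1).integral_prod_right',
    (eLpNorm_ouFun_le v t hg).trans_lt hg.2⟩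

theorem ouFun_congr (v t : ℝ≥0) {f g : ℝ → ℝ} (hfg : f =ᵐ[gaussianReal 0 v] g) :
    ouFun v t f =ᵐ[gaussianReal 0 v] ouFun v t g := by
  have h := Measure.ae_ae_of_ae_prod
    ((measurePreserving_ou v t).quasiMeasurePreserving.ae_eq_comp hfg)
  filter_upwards [h] with a ha
  exact integral_congr_ae ha

theorem ouFun_add (v t : ℝ≥0) {f g : ℝ → ℝ} (hf : MemLp f 2 (gaussianReal 0 v))
    (hg : MemLp g 2 (gaussianReal 0 v)) :
    ouFun v t (f + g) =ᵐ[gaussianReal 0 v] ouFun v t f + ouFun v t g := by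
  have hφ := measurePreserving_ou v t
  filter_upwards [((hf.comp_measurePreserving hφ).integrable (by norm_num)).prod_right_ae,
    ((hg.comp_measurePreserving hφ).integrable (by norm_num)).prod_right_ae] with a h1 h2
  exact integral_add h1 h2

/-- `Q_t` as a bounded operator on `L²(ν)`, `ν` the centered Gaussian law of variance `v`. -/
def ouOp (v t : ℝ≥0) :
    Lp ℝ 2 (gaussianReal 0 v) →L[ℝ] Lp ℝ 2 (gaussianReal 0 v) :=
  LinearMap.mkContinuous
    { toFun := fun g => (memLp_ouFun v t (Lp.memLp g)).toLp (ouFun v t g)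
      map_add' := by
        intro f g
        rw [← MemLp.toLp_add, MemLp.toLp_eq_toLp_iff]
        exact (ouFun_congr v t (Lp.coeFn_add f g)).trans (ouFun_add v t (Lp.memLp f) (Lp.memLp g))
      map_smul' := by
        intro c g
        rw [RingHom.id_apply, ← MemLp.toLp_const_smul, MemLp.toLp_eq_toLp_iff]
        refine (ouFun_congr v t (Lp.coeFn_smul c g)).trans (Filter.Eventually.of_forall ?_)
        intro a
        exact integral_const_mul c _ }
    1
    (by
      intro g
      rw [one_mul]
      change ‖(memLp_ouFun v t (Lp.memLp g)).toLp (ouFun v t g)‖ ≤ ‖g‖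
      rw [Lp.norm_toLp, Lp.norm_def]
      exact ENNReal.toReal_mono (Lp.eLpNorm_ne_top g) (eLpNorm_ouFun_le v t (Lp.memLp g)))

/-- Multiplication by the indicator function of `[h, ∞)`, as a bounded operator on `L²(μ)`. -/
def cutoff (μ : Measure ℝ) (h : ℝ) : Lp ℝ 2 μ →L[ℝ] Lp ℝ 2 μ :=
  LinearMap.mkContinuous
    { toFun := fun g =>
        ((Lp.memLp g).indicator (measurableSet_Ici (a := h))).toLp ((Set.Ici h).indicator g)
      map_add' := by
        intro f g
        rw [← MemLp.toLp_add, MemLp.toLp_eq_toLp_iff]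
        filter_upwards [Lp.coeFn_add f g] with a ha
        simp only [Pi.add_apply, Set.indicator_apply]
        split_ifs
        · exact ha
        · simp
      map_smul' := by
        intro c g
        rw [RingHom.id_apply, ← MemLp.toLp_const_smul, MemLp.toLp_eq_toLp_iff]
        filter_upwards [Lp.coeFn_smul c g] with a ha
        simp only [Pi.smul_apply, Set.indicator_apply]
        split_ifs
        · exact ha
        · simp }
    1
    (by
      intro g
      rw [one_mul]
      change ‖((Lp.memLp g).indicator (measurableSet_Ici (a := h))).toLp
        ((Set.Ici h).indicator g)‖ ≤ ‖g‖
      rw [Lp.norm_toLp, Lp.norm_def]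
      exact ENNReal.toReal_mono (Lp.eLpNorm_ne_top g) (eLpNorm_indicator_le _))

/-- The variance `σ² = d / (d² - 1)`. -/
def sigmaSq (d : ℕ) : ℝ≥0 := Real.toNNReal ((d : ℝ) / ((d : ℝ) ^ 2 - 1))

/-- The centered Gaussian law on `ℝ` with variance `σ² = d / (d² - 1)`. -/
abbrev nu (d : ℕ) : Measure ℝ := gaussianReal 0 (sigmaSq d)

/-- `L_h = π_h (d Q_{log d}) π_h` on `L²(ν)`. -/
def Lop (d : ℕ) (h : ℝ) : Lp ℝ 2 (nu d) →L[ℝ] Lp ℝ 2 (nu d) :=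
  cutoff (nu d) h ∘L
    ((d : ℝ) • ouOp (sigmaSq d) ⟨Real.log d, Real.log_natCast_nonneg d⟩) ∘L cutoff (nu d) h

/-- `λ_h`, the operator norm of `L_h` on `L²(ν)`. -/
def lam (d : ℕ) (h : ℝ) : ℝ := ‖Lop d h‖

/-- `χ` is a nonnegative function of unit `L²(ν)`-norm, continuous and positive on `[h, ∞)`,
vanishing on `(-∞, h)`, with `L_h χ = λ_h χ` in `L²(ν)`. -/
structure IsPrincipalEigenfunction (d : ℕ) (h : ℝ) (χ : ℝ → ℝ) : Prop where
  nonneg : ∀ a, 0 ≤ χ a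
  continuousOn : ContinuousOn χ (Set.Ici h)
  pos : ∀ a, h ≤ a → 0 < χ a
  eq_zero : ∀ a, a < h → χ a = 0
  norm_eq_one : eLpNorm χ 2 (nu d) = 1
  eigen : ∃ hχ : MemLp χ 2 (nu d), Lop d h (hχ.toLp χ) = lam d h • hχ.toLp χ

end OUTree

end

/-! Everything rests on Gaussian hypercontractivity in one form: if `ρ² = 1/N`, the noise operator
with correlation `ρ` contracts `L²` into `L^{N+1}` (`lintegral_lnoise_pow_le`). For `g ≥ 0`, the
integral of `(Q g)^{N+1}` is the expectation of `∏ g(Xᵢ)`, where the `N+1` Gaussians `Xᵢ` share one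
variable and have pairwise correlation `1/N`. The same vector arises by placing independent
Gaussians on the edges of the complete graph on `N+1` vertices and letting `Xᵢ` be the normalized
sum at vertex `i`. Each edge variable then enters only two factors, so Finner's inequality with all
exponents `1/2` bounds the expectation by `∏ ‖g‖₂`.

Hypercontractivity makes the images under `Q` of the `L²` unit ball uniformly square integrable.
Evaluation of `Q g` at a point is an inner product with the Mehler kernel, so weak convergence
becomes pointwise convergence, and then norm convergence by Vitali (`tendsto_ouOp_of_weak`). Hence
`L_h` attains its norm. It is symmetric, positivity preserving and, the kernel being positive,
positivity improving on `[h, ∞)`; the Perron–Frobenius argument yields a nonnegative eigenvector and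
simplicity. The eigenvalue equation itself supplies the continuous positive representative.

The eigenfunction satisfies `χ ≤ (d/λ) Q χ`. Iterating gives `χ ≤ (d/λ)^k Q^k χ`, and `Q^k` has
correlation `d^{-k}`, so hypercontractivity with `N = d^{2k}` gives the norm bounds.

Finally, strict monotonicity holds because an eigenfunction for a larger threshold vanishes where
one for the smaller threshold must be positive. Continuity and the limit `0` at `+∞` follow from the
smallness of `Q` cut off to a set of small measure; the limit `d` at `-∞` is seen on the constant
function. -/

/-! ### Finner's inequality on product spaces. -/

/-- **Finner's inequality**, marginal form. -/
theorem lmarginal_prod_rpow_le {ι E : Type*} [DecidableEq ι] [Fintype ι] [DecidableEq E]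
    {X : E → Type*} [∀ e, MeasurableSpace (X e)] (μ : ∀ e, Measure (X e))
    [∀ e, IsProbabilityMeasure (μ e)] (A : E → Finset ι) {p : ι → ℝ} (hp0 : ∀ i, 0 ≤ p i)
    (hp : ∀ e, ∑ i ∈ A e, p i = 1) {F : ι → (∀ e, X e) → ℝ≥0∞} (hF : ∀ i, Measurable (F i))
    (hA : ∀ e, ∀ i ∉ A e, ∀ x y, F i (Function.update x e y) = F i x) (S : Finset E) :
    ∫⋯∫⁻_S, (fun x => ∏ i, F i x ^ p i) ∂μ ≤ fun x => ∏ i, (∫⋯∫⁻_S, F i ∂μ) x ^ p i := by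
  induction S using Finset.induction with
  | empty => simp
  | insert e S he ih =>
    intro x
    have hm : Measurable (fun x => ∏ i, F i x ^ p i) :=
      Finset.measurable_prod _ fun i _ => (hF i).pow_const _
    have hGm : ∀ i, Measurable (∫⋯∫⁻_S, F i ∂μ) := fun i => (hF i).lmarginal μ
    have hGc : ∀ i ∉ A e, ∀ y, (∫⋯∫⁻_S, F i ∂μ) (Function.update x e y)
        = (∫⋯∫⁻_S, F i ∂μ) x := by
      intro i hi y
      rw [lmarginal_update_of_notMem (hF i) he]
      congr 1
      ext z
      exact hA e i hi z y
    have hup : Measurable fun y => Function.update x e y := measurable_update x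
    rw [lmarginal_insert _ hm he]
    calc ∫⁻ y, (∫⋯∫⁻_S, (fun x => ∏ i, F i x ^ p i) ∂μ) (Function.update x e y) ∂μ e
        ≤ ∫⁻ y, ∏ i, (∫⋯∫⁻_S, F i ∂μ) (Function.update x e y) ^ p i ∂μ e :=
          lintegral_mono fun y => ih _
      -- Only the factors in `A e` feel the coordinate `e`. The others leave the integral, and
      -- Hölder in one variable handles the rest, whose exponents sum to one.
      _ = ∫⁻ y, (∏ i ∈ (A e)ᶜ, (∫⋯∫⁻_S, F i ∂μ) x ^ p i) *
            ∏ i ∈ A e, (∫⋯∫⁻_S, F i ∂μ) (Function.update x e y) ^ p i ∂μ e := by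
          refine lintegral_congr fun y => ?_
          rw [← Finset.prod_compl_mul_prod (A e)]
          congr 1
          refine Finset.prod_congr rfl fun i hi => ?_
          rw [hGc i (Finset.mem_compl.1 hi)]
      _ = (∏ i ∈ (A e)ᶜ, (∫⋯∫⁻_S, F i ∂μ) x ^ p i) *
            ∫⁻ y, ∏ i ∈ A e, (∫⋯∫⁻_S, F i ∂μ) (Function.update x e y) ^ p i ∂μ e :=
          lintegral_const_mul _ (Finset.measurable_prod _ fun i _ =>
            ((hGm i).comp hup).pow_const _)
      _ ≤ (∏ i ∈ (A e)ᶜ, (∫⋯∫⁻_S, F i ∂μ) x ^ p i) *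
            ∏ i ∈ A e, (∫⁻ y, (∫⋯∫⁻_S, F i ∂μ) (Function.update x e y) ∂μ e) ^ p i := by
          gcongr
          exact ENNReal.lintegral_prod_norm_pow_le (A e)
            (fun i _ => ((hGm i).comp hup).aemeasurable) (hp e) fun i _ => hp0 i
      _ = ∏ i, (∫⋯∫⁻_(insert e S), F i ∂μ) x ^ p i := by
          rw [← Finset.prod_compl_mul_prod (A e) (fun i => (∫⋯∫⁻_(insert e S), F i ∂μ) x ^ p i)]
          congr 1
          · refine Finset.prod_congr rfl fun i hi => ?_
            rw [lmarginal_insert _ (hF i) he]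
            simp [hGc i (Finset.mem_compl.1 hi)]
          · refine Finset.prod_congr rfl fun i hi => ?_
            rw [lmarginal_insert _ (hF i) he]

/-- **Finner's inequality**: a Hölder inequality for functions on a product of probability spaces,
each depending on some of the coordinates only. -/
theorem lintegral_pi_prod_rpow_le {ι E : Type*} [DecidableEq ι] [Fintype ι] [DecidableEq E]
    [Fintype E] {X : E → Type*} [∀ e, MeasurableSpace (X e)] (μ : ∀ e, Measure (X e))
    [∀ e, IsProbabilityMeasure (μ e)] (A : E → Finset ι) {p : ι → ℝ} (hp0 : ∀ i, 0 ≤ p i)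
    (hp : ∀ e, ∑ i ∈ A e, p i = 1) {F : ι → (∀ e, X e) → ℝ≥0∞} (hF : ∀ i, Measurable (F i))
    (hA : ∀ e, ∀ i ∉ A e, ∀ x y, F i (Function.update x e y) = F i x) :
    ∫⁻ x, ∏ i, F i x ^ p i ∂Measure.pi μ ≤ ∏ i, (∫⁻ x, F i x ∂Measure.pi μ) ^ p i := by
  have : ∀ e, Nonempty (X e) := fun e => (μ e).nonempty_of_neZero
  have h := lmarginal_prod_rpow_le μ A hp0 hp hF hA Finset.univ (Classical.arbitrary _)
  simpa only [lmarginal_univ] using h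

/-! ### Laws of linear images of Gaussian vectors. -/

/-- Independence factors the characteristic function over the coordinates. The law thus depends on
`M` only through the quadratic form in `L` appearing in the exponent. -/
theorem charFunDual_map_pi_gaussianReal {E W : Type*} [Fintype E]
    [NormedAddCommGroup W] [NormedSpace ℝ W] [MeasurableSpace W] [BorelSpace W]
    (v : ℝ≥0) (M : (E → ℝ) →L[ℝ] W) (L : StrongDual ℝ W) [DecidableEq E] :
    charFunDual ((Measure.pi fun _ : E => gaussianReal 0 v).map M) L
      = Complex.exp (-(v * (∑ e, (L (M (Pi.single e 1))) ^ 2 : ℝ) / 2)) := by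
  rw [charFunDual_apply, integral_map M.continuous.aemeasurable
    (by fun_prop)]
  have h1 : ∀ z : E → ℝ, L (M z) = ∑ e, L (M (Pi.single e 1)) * z e := by
    intro z
    conv_lhs => rw [pi_eq_sum_univ' z]
    simp [mul_comm]
  have h2 : ∀ z : E → ℝ, Complex.exp (L (M z) * Complex.I)
      = ∏ e, Complex.exp ((L (M (Pi.single e 1)) : ℂ) * z e * Complex.I) := by
    intro z
    rw [h1, ← Complex.exp_sum, ← Finset.sum_mul]
    push_cast
    rfl
  simp_rw [h2]
  rw [integral_fintype_prod_eq_prod (𝕜 := ℂ)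
    (fun e (x : ℝ) => Complex.exp ((L (M (Pi.single e 1)) : ℂ) * x * Complex.I))]
  have h3 : ∀ e, ∫ x : ℝ, Complex.exp ((L (M (Pi.single e 1)) : ℂ) * x * Complex.I)
      ∂gaussianReal 0 v = Complex.exp (-(v * (L (M (Pi.single e 1)) : ℂ) ^ 2 / 2)) := by
    intro e
    rw [← charFun_apply_real, charFun_gaussianReal]
    simp
  simp_rw [h3]
  rw [← Complex.exp_sum]
  congr 1
  push_cast
  rw [Finset.sum_neg_distrib, ← Finset.sum_div, ← Finset.mul_sum]

/-- Linear images of standard Gaussian vectors with the same covariance have the same law. -/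
theorem map_pi_gaussianReal_eq {E E' W : Type*} [Fintype E] [Fintype E'] [DecidableEq E]
    [DecidableEq E'] [NormedAddCommGroup W] [NormedSpace ℝ W] [MeasurableSpace W] [BorelSpace W]
    [SecondCountableTopology W] [CompleteSpace W]
    (v : ℝ≥0) (M : (E → ℝ) →L[ℝ] W) (M' : (E' → ℝ) →L[ℝ] W)
    (h : ∀ L : StrongDual ℝ W,
      ∑ e, (L (M (Pi.single e 1))) ^ 2 = ∑ e, (L (M' (Pi.single e 1))) ^ 2) :
    (Measure.pi fun _ : E => gaussianReal 0 v).map M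
      = (Measure.pi fun _ : E' => gaussianReal 0 v).map M' := by
  have := Measure.isProbabilityMeasure_map (μ := Measure.pi fun _ : E => gaussianReal 0 v)
    M.continuous.aemeasurable
  have := Measure.isProbabilityMeasure_map (μ := Measure.pi fun _ : E' => gaussianReal 0 v)
    M'.continuous.aemeasurable
  refine Measure.ext_of_charFunDual (funext fun L => ?_)
  rw [charFunDual_map_pi_gaussianReal, charFunDual_map_pi_gaussianReal, h]

/-- Used to expand a power of a noise average into an average over independent copies of the noise.
-/
theorem lintegral_pi_prod_eq_pow {ι X : Type*} [Fintype ι] [MeasurableSpace X] (μ : Measure X)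
    [IsProbabilityMeasure μ] {f : X → ℝ≥0∞} (hf : Measurable f) :
    ∫⁻ y, ∏ i, f (y i) ∂(Measure.pi fun _ : ι => μ) = (∫⁻ x, f x ∂μ) ^ Fintype.card ι := by
  rw [lintegral_prod_eq_prod_lintegral_of_indepFun Finset.univ (fun i (y : ι → X) => f (y i))
    (iIndepFun_pi (X := fun _ => f) fun _ => hf.aemeasurable)
    fun i => hf.comp (measurable_pi_apply i)]
  have : ∀ i : ι, ∫⁻ y, f (y i) ∂(Measure.pi fun _ : ι => μ) = ∫⁻ x, f x ∂μ := fun i =>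
    (measurePreserving_eval (fun _ : ι => μ) i).lintegral_comp hf
  simp [this]

/-! ### Gaussian hypercontractivity: star versus complete graph. -/

/-- The Ornstein-Uhlenbeck operator with correlation `ρ` on nonnegative functions. -/
noncomputable def lnoise (v : ℝ≥0) (ρ : ℝ) (g : ℝ → ℝ≥0∞) (a : ℝ) : ℝ≥0∞ :=
  ∫⁻ y, g (ρ * a + Real.sqrt (1 - ρ ^ 2) * y) ∂gaussianReal 0 v

/-- The vector `(ρ z₀ + √(1 - ρ²) zᵢ)ᵢ`. -/
noncomputable def starMap (n : ℕ) (ρ : ℝ) : (Fin (n + 1) → ℝ) →L[ℝ] (Fin n → ℝ) :=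
  ContinuousLinearMap.pi fun i =>
    ρ • ContinuousLinearMap.proj 0 + Real.sqrt (1 - ρ ^ 2) • ContinuousLinearMap.proj i.succ

/-- The vector indexed by the vertices of the complete graph whose entry at a vertex is the
normalized sum of the variables on the (oriented) edges at this vertex. -/
noncomputable def edgeMap (n : ℕ) (c : ℝ) :
    ({p : Fin n × Fin n // p.1 ≠ p.2} → ℝ) →L[ℝ] (Fin n → ℝ) :=
  ContinuousLinearMap.pi fun i =>
    ∑ e : {p : Fin n × Fin n // p.1 ≠ p.2},
      (if i ∈ ({e.1.1, e.1.2} : Finset (Fin n)) then c else 0) • ContinuousLinearMap.proj e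

/-- The quadratic form of the matrix with `1` on the diagonal and `ρ²` off it. -/
theorem sum_starMap_sq {n : ℕ} {ρ : ℝ} (hρ : ρ ^ 2 ≤ 1) (L : StrongDual ℝ (Fin n → ℝ)) :
    ∑ e, (L (starMap n ρ (Pi.single e 1))) ^ 2
      = ρ ^ 2 * (∑ i, L (Pi.single i 1)) ^ 2 + (1 - ρ ^ 2) * ∑ i, (L (Pi.single i 1)) ^ 2 := by
  have h0 : starMap n ρ (Pi.single 0 1) = ∑ i, ρ • Pi.single i (1 : ℝ) := by
    ext j
    simp [starMap, Finset.sum_apply, Pi.single_apply]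
  have h1 : ∀ i : Fin n, starMap n ρ (Pi.single i.succ 1)
      = Real.sqrt (1 - ρ ^ 2) • Pi.single i (1 : ℝ) := by
    intro i
    ext j
    simp [starMap, Pi.single_apply]
  rw [Fin.sum_univ_succ, h0]
  simp_rw [h1, map_sum, map_smul, smul_eq_mul, mul_pow, Real.sq_sqrt (sub_nonneg.2 hρ)]
  rw [← Finset.mul_sum, ← Finset.mul_sum, mul_pow]

/-- A vertex lies on `2(n-1)` oriented edges, which gives variance `2(n-1)c²`; two vertices share
both orientations of one edge, which gives covariance `2c²`. For `n = N+1` and `c² = 1/(2N)` these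
are `1` and `1/N`. -/
theorem sum_edgeMap_sq {n : ℕ} (c : ℝ) (L : StrongDual ℝ (Fin n → ℝ)) :
    ∑ e, (L (edgeMap n c (Pi.single e 1))) ^ 2
      = c ^ 2 * (2 * (∑ i, L (Pi.single i 1)) ^ 2
        + 2 * ((n : ℝ) - 2) * ∑ i, (L (Pi.single i 1)) ^ 2) := by
  have h1 : ∀ e, edgeMap n c (Pi.single e 1)
      = c • (Pi.single e.1.1 (1 : ℝ) + Pi.single e.1.2 (1 : ℝ)) := by
    rintro ⟨⟨a, b⟩, hab⟩
    ext j
    simp only [ne_eq] at hab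
    simp only [edgeMap, ContinuousLinearMap.coe_pi', sum_apply,
      smul_apply, ContinuousLinearMap.proj_apply, Pi.single_apply,
      smul_eq_mul, mul_ite, mul_one, mul_zero, Finset.sum_ite_eq', Finset.mem_univ, if_true,
      Finset.mem_insert, Finset.mem_singleton, Pi.smul_apply, Pi.add_apply]
    grind
  simp_rw [h1, map_smul, map_add, smul_eq_mul, mul_pow]
  set l : Fin n → ℝ := fun i => L (Pi.single i 1)
  have h2 : ∑ e : {p : Fin n × Fin n // p.1 ≠ p.2}, c ^ 2 * (l e.1.1 + l e.1.2) ^ 2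
      = ∑ i, ∑ j, c ^ 2 * (l i + l j) ^ 2 - ∑ i, c ^ 2 * (l i + l i) ^ 2 := by
    rw [← Finset.sum_subtype (Finset.univ.filter fun p : Fin n × Fin n => p.1 ≠ p.2)
      (by simp) (fun p : Fin n × Fin n => c ^ 2 * (l p.1 + l p.2) ^ 2), Finset.sum_filter,
      Fintype.sum_prod_type, ← Finset.sum_sub_distrib]
    refine Finset.sum_congr rfl fun i _ => ?_
    rw [eq_sub_iff_add_eq, ← Finset.sum_add_sum_compl {i}, ← Finset.sum_add_sum_compl {i}
      (fun j => c ^ 2 * (l i + l j) ^ 2)]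
    simp only [Finset.sum_singleton, ne_eq, not_true_eq_false, if_false, zero_add]
    rw [add_comm]
    congr 1
    refine Finset.sum_congr rfl fun j hj => if_pos ?_
    simpa [eq_comm] using hj
  have h3 : ∀ i, ∑ j, c ^ 2 * (l i + l j) ^ 2
      = c ^ 2 * (n * l i ^ 2 + 2 * l i * ∑ j, l j + ∑ j, l j ^ 2) := by
    intro i
    rw [← Finset.mul_sum]
    congr 1
    simp_rw [add_sq, Finset.sum_add_distrib, ← Finset.mul_sum]
    simp
  have h4 : ∀ i, c ^ 2 * (l i + l i) ^ 2 = c ^ 2 * (4 * l i ^ 2) := fun i => by ring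
  change ∑ e : {p : Fin n × Fin n // p.1 ≠ p.2}, c ^ 2 * (l e.1.1 + l e.1.2) ^ 2
    = c ^ 2 * (2 * (∑ i, l i) ^ 2 + 2 * ((n : ℝ) - 2) * ∑ i, l i ^ 2)
  rw [h2]
  simp_rw [h3, h4]
  rw [← Finset.mul_sum, ← Finset.mul_sum, Finset.sum_add_distrib, Finset.sum_add_distrib,
    ← Finset.mul_sum, ← Finset.mul_sum, ← Finset.sum_mul, ← Finset.mul_sum]
  simp
  ring

/-- The star and the complete graph produce the same equicorrelated Gaussian vector. -/
theorem map_starMap_eq_map_edgeMap (v : ℝ≥0) {N : ℕ} (hN : 0 < N) {ρ : ℝ} (hρ : ρ ^ 2 = 1 / N) :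
    (Measure.pi fun _ : Fin (N + 1 + 1) => gaussianReal 0 v).map (starMap (N + 1) ρ)
      = (Measure.pi fun _ => gaussianReal 0 v).map (edgeMap (N + 1) (Real.sqrt (1 / (2 * N)))) := by
  have hN' : (1 : ℝ) ≤ N := by exact_mod_cast hN
  refine map_pi_gaussianReal_eq v _ _ fun L => ?_
  rw [sum_starMap_sq (by rw [hρ]; exact (div_le_one (by linarith)).2 hN'), sum_edgeMap_sq,
    Real.sq_sqrt (by positivity), hρ]
  push_cast
  field_simp
  ring

theorem map_starMap_apply (v : ℝ≥0) {n : ℕ} {ρ : ℝ} (hρ : ρ ^ 2 ≤ 1) (i : Fin n) :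
    (Measure.pi fun _ : Fin (n + 1) => gaussianReal 0 v).map (fun z => starMap n ρ z i)
      = gaussianReal 0 v := by
  have h := map_pi_gaussianReal_eq v ((ContinuousLinearMap.proj i).comp (starMap n ρ))
    (ContinuousLinearMap.proj () : (Unit → ℝ) →L[ℝ] ℝ) (fun L => by
      have := sum_starMap_sq hρ (L.comp (ContinuousLinearMap.proj i))
      simp only [ContinuousLinearMap.comp_apply, ContinuousLinearMap.proj_apply] at this ⊢
      rw [this]
      have h1 : ∀ j, L ((Pi.single j (1 : ℝ) : Fin n → ℝ) i) = if i = j then L 1 else 0 := by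
        intro j
        rw [Pi.single_apply]
        split_ifs <;> simp
      simp only [h1, ite_pow]
      simp
      ring)
  refine h.trans ?_
  exact (measurePreserving_eval (fun _ : Unit => gaussianReal 0 v) ()).map_eq

/-- **Gaussian hypercontractivity** from `L²` to `L^{N+1}`, with `ρ² = 1 / N`. -/
theorem lintegral_lnoise_pow_le (v : ℝ≥0) {N : ℕ} (hN : 0 < N) {ρ : ℝ} (hρ : ρ ^ 2 = 1 / N)
    {g : ℝ → ℝ≥0∞} (hg : Measurable g) :
    ∫⁻ a, lnoise v ρ g a ^ (N + 1) ∂gaussianReal 0 v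
      ≤ ((∫⁻ a, g a ^ 2 ∂gaussianReal 0 v) ^ (1 / 2 : ℝ)) ^ (N + 1) := by
  have hN' : (1 : ℝ) ≤ N := by exact_mod_cast hN
  have hρ1 : ρ ^ 2 ≤ 1 := by rw [hρ]; exact (div_le_one (by linarith)).2 hN'
  set c := Real.sqrt (1 / (2 * N))
  set s := Real.sqrt (1 - ρ ^ 2)
  have hlaw := map_starMap_eq_map_edgeMap v hN hρ
  have hprod : Measurable fun x : Fin (N + 1) → ℝ => ∏ i, g (x i) :=
    Finset.measurable_prod _ fun i _ => hg.comp (measurable_pi_apply i)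
  have hpow : ∀ a, lnoise v ρ g a ^ (N + 1)
      = ∫⁻ y, ∏ i, g (ρ * a + s * y i) ∂(Measure.pi fun _ : Fin (N + 1) => gaussianReal 0 v) := by
    intro a
    rw [lintegral_pi_prod_eq_pow (gaussianReal 0 v) (f := fun y => g (ρ * a + s * y))
      (hg.comp (by fun_prop)), Fintype.card_fin]
    rfl
  -- The variable `z 0` plays the role of `a`, and the `N+1` others are the independent copies of
  -- the noise.
  have hstar : ∫⁻ a, lnoise v ρ g a ^ (N + 1) ∂gaussianReal 0 v
      = ∫⁻ z, ∏ i, g (starMap (N + 1) ρ z i)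
        ∂(Measure.pi fun _ : Fin (N + 1 + 1) => gaussianReal 0 v) := by
    simp_rw [hpow]
    have hm : Measurable fun p : ℝ × (Fin (N + 1) → ℝ) => ∏ i, g (ρ * p.1 + s * p.2 i) :=
      Finset.measurable_prod _ fun i _ => hg.comp (by fun_prop)
    rw [← lintegral_prod (μ := gaussianReal 0 v)
      (fun p : ℝ × (Fin (N + 1) → ℝ) => ∏ i, g (ρ * p.1 + s * p.2 i)) hm.aemeasurable]
    rw [← (measurePreserving_piFinSuccAbove (fun _ : Fin (N + 1 + 1) => gaussianReal 0 v)
      0).lintegral_comp hm]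
    refine lintegral_congr fun z => ?_
    simp [starMap, s, MeasurableEquiv.piFinSuccAbove, Fin.insertNthEquiv, Fin.tail]
  -- The marginals of the edge vector are read off from the star, which has the same law.
  have hcoord : ∀ i, ∫⁻ z, g (edgeMap (N + 1) c z i) ^ 2 ∂(Measure.pi fun _ => gaussianReal 0 v)
      = ∫⁻ a, g a ^ 2 ∂gaussianReal 0 v := by
    intro i
    have hgi : Measurable fun x : Fin (N + 1) → ℝ => g (x i) ^ 2 :=
      (hg.comp (measurable_pi_apply i)).pow_const _
    rw [← lintegral_map hgi (edgeMap (N + 1) c).continuous.measurable, ← hlaw,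
      lintegral_map hgi (starMap (N + 1) ρ).continuous.measurable]
    conv_rhs => rw [← map_starMap_apply v hρ1 i]
    rw [lintegral_map (hg.pow_const _) (by fun_prop)]
  rw [hstar, ← lintegral_map hprod (starMap (N + 1) ρ).continuous.measurable, hlaw,
    lintegral_map hprod (edgeMap (N + 1) c).continuous.measurable]
  have hsq : ∀ x : ℝ≥0∞, (x ^ 2) ^ (1 / 2 : ℝ) = x := by
    intro x
    rw [← ENNReal.rpow_natCast, ← ENNReal.rpow_mul]
    norm_num
  -- Each edge affects exactly its two endpoints, so the weights `1/2 + 1/2` are admissible. The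
  -- functions are `g²`, so that the exponent `1/2` restores `g` on the left.
  have hfin := lintegral_pi_prod_rpow_le
    (μ := fun _ : {p : Fin (N + 1) × Fin (N + 1) // p.1 ≠ p.2} => gaussianReal 0 v)
    (A := fun e => {e.1.1, e.1.2}) (p := fun _ : Fin (N + 1) => (1 / 2 : ℝ))
    (fun _ => by norm_num)
    (fun e => by rw [Finset.sum_pair e.2]; norm_num)
    (F := fun i z => g (edgeMap (N + 1) c z i) ^ 2)
    (fun i => (hg.comp (by fun_prop)).pow_const _)
    (fun e i hi x y => by
      have : edgeMap (N + 1) c (Function.update x e y) i = edgeMap (N + 1) c x i := by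
        simp only [edgeMap, ContinuousLinearMap.coe_pi', sum_apply,
          smul_apply, ContinuousLinearMap.proj_apply]
        refine Finset.sum_congr rfl fun e' _ => ?_
        rcases eq_or_ne e' e with rfl | h
        · rw [if_neg hi]; simp
        · rw [Function.update_of_ne h]
      simp only [this])
  simp_rw [hsq, hcoord] at hfin
  simpa using hfin

/-! ### Semigroup property and iterated subsolutions. -/

theorem measurable_lnoise (v : ℝ≥0) (ρ : ℝ) {g : ℝ → ℝ≥0∞} (hg : Measurable g) :
    Measurable (lnoise v ρ g) :=
  Measurable.lintegral_prod_right' (f := fun p : ℝ × ℝ => g (ρ * p.1 + Real.sqrt (1 - ρ ^ 2) * p.2))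
    (hg.comp (by fun_prop))

theorem measurePreserving_noise (v : ℝ≥0) {a b : ℝ} (h : a ^ 2 + b ^ 2 = 1) :
    MeasurePreserving (fun p : ℝ × ℝ => a * p.1 + b * p.2)
      ((gaussianReal 0 v).prod (gaussianReal 0 v)) (gaussianReal 0 v) := by
  refine ⟨by fun_prop, ?_⟩
  have h1 : (fun p : ℝ × ℝ => a * p.1 + b * p.2)
      = (fun p : ℝ × ℝ => p.1 + p.2) ∘ Prod.map (fun x => a * x) (fun x => b * x) := rfl
  rw [h1, ← Measure.map_map (by fun_prop) (by fun_prop),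
    ← Measure.map_prod_map _ _ (by fun_prop) (by fun_prop),
    gaussianReal_map_const_mul, gaussianReal_map_const_mul]
  change Measure.conv _ _ = _
  rw [gaussianReal_conv_gaussianReal]
  congr 1
  · simp
  · ext
    push_cast
    rw [← add_mul, h, one_mul]

theorem lnoise_congr_le (v : ℝ≥0) {ρ : ℝ} (hρ : ρ ^ 2 ≤ 1) {f g : ℝ → ℝ≥0∞}
    (hfg : f ≤ᵐ[gaussianReal 0 v] g) : lnoise v ρ f ≤ᵐ[gaussianReal 0 v] lnoise v ρ g := by
  have h := Measure.ae_ae_of_ae_prod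
    ((measurePreserving_noise v (a := ρ) (b := Real.sqrt (1 - ρ ^ 2))
      (by rw [Real.sq_sqrt (by linarith)]; ring)).quasiMeasurePreserving.ae hfg)
  filter_upwards [h] with a ha
  exact lintegral_mono_ae ha

/-- The semigroup property. -/
theorem lnoise_lnoise (v : ℝ≥0) {ρ ρ' : ℝ} (hρ : ρ ^ 2 ≤ 1) (hρ' : ρ' ^ 2 ≤ 1)
    {g : ℝ → ℝ≥0∞} (hg : Measurable g) :
    lnoise v ρ (lnoise v ρ' g) = lnoise v (ρ * ρ') g := by
  ext a
  set s := Real.sqrt (1 - ρ ^ 2)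
  set s' := Real.sqrt (1 - ρ' ^ 2)
  set r := Real.sqrt (1 - (ρ * ρ') ^ 2)
  have hr2 : (ρ * ρ') ^ 2 ≤ 1 := by
    rw [mul_pow]; exact mul_le_one₀ hρ (sq_nonneg _) hρ'
  have hs : s ^ 2 = 1 - ρ ^ 2 := Real.sq_sqrt (by linarith)
  have hs' : s' ^ 2 = 1 - ρ' ^ 2 := Real.sq_sqrt (by linarith)
  have hr : r ^ 2 = 1 - (ρ * ρ') ^ 2 := Real.sq_sqrt (by linarith)
  have hsum : (ρ' * s) ^ 2 + s' ^ 2 = r ^ 2 := by rw [mul_pow, hs, hs', hr]; ring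
  have hlhs : lnoise v ρ (lnoise v ρ' g) a = ∫⁻ p : ℝ × ℝ,
      g (ρ * ρ' * a + ((ρ' * s) * p.1 + s' * p.2))
        ∂((gaussianReal 0 v).prod (gaussianReal 0 v)) := by
    have hm : Measurable fun p : ℝ × ℝ => g (ρ * ρ' * a + ((ρ' * s) * p.1 + s' * p.2)) :=
      hg.comp (by fun_prop)
    rw [lintegral_prod _ hm.aemeasurable]
    refine lintegral_congr fun y => lintegral_congr fun y' => ?_
    congr 1
    change ρ' * (ρ * a + s * y) + s' * y' = _
    ring
  have hlaw : ((gaussianReal 0 v).prod (gaussianReal 0 v)).map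
      (fun p : ℝ × ℝ => (ρ' * s) * p.1 + s' * p.2) = (gaussianReal 0 v).map (fun y => r * y) := by
    have h1 : (fun p : ℝ × ℝ => (ρ' * s) * p.1 + s' * p.2)
        = (fun p : ℝ × ℝ => p.1 + p.2) ∘ Prod.map (fun x => (ρ' * s) * x) (fun x => s' * x) := rfl
    rw [h1, ← Measure.map_map (by fun_prop) (by fun_prop),
      ← Measure.map_prod_map _ _ (by fun_prop) (by fun_prop),
      gaussianReal_map_const_mul, gaussianReal_map_const_mul, gaussianReal_map_const_mul]
    change Measure.conv _ _ = _
    rw [gaussianReal_conv_gaussianReal]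
    congr 1
    · simp
    · ext
      push_cast
      rw [← add_mul, hsum]
  have hm : Measurable fun x => g (ρ * ρ' * a + x) := hg.comp (by fun_prop)
  rw [hlhs, ← lintegral_map hm (by fun_prop), hlaw, lintegral_map hm (by fun_prop)]
  rfl

theorem lnoise_const_mul (v : ℝ≥0) (ρ : ℝ) {c : ℝ≥0∞} (hc : c ≠ ∞) (g : ℝ → ℝ≥0∞) :
    lnoise v ρ (fun a => c * g a) = fun a => c * lnoise v ρ g a := by
  ext a
  exact lintegral_const_mul' c _ hc

/-- A subsolution `g ≤ c Q g` satisfies `g ≤ cᵏ Qᵏ g`. -/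
theorem ae_le_lnoise_pow (v : ℝ≥0) {ρ : ℝ} (hρ : ρ ^ 2 ≤ 1) {c : ℝ≥0∞} (hc : c ≠ ∞)
    {g : ℝ → ℝ≥0∞} (hg : Measurable g)
    (h : g ≤ᵐ[gaussianReal 0 v] fun a => c * lnoise v ρ g a) (k : ℕ) :
    g ≤ᵐ[gaussianReal 0 v] fun a => c ^ k * lnoise v (ρ ^ k) g a := by
  induction k with
  | zero =>
    refine Filter.Eventually.of_forall fun a => ?_
    -- At correlation `ρ ^ 0 = 1` the noise has weight `√(1 - 1) = 0`, so `lnoise` is the identity.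
    simp [lnoise]
  | succ k ih =>
    have h1 := lnoise_congr_le v hρ ih
    rw [lnoise_const_mul v ρ (ENNReal.pow_ne_top hc), lnoise_lnoise v hρ
      (by rw [← pow_mul, mul_comm, pow_mul]; exact pow_le_one₀ (sq_nonneg _) hρ) hg] at h1
    filter_upwards [h, h1] with a ha h1a
    calc g a ≤ c * lnoise v ρ g a := ha
      _ ≤ c * (c ^ k * lnoise v (ρ * ρ ^ k) g a) := by gcongr
      _ = c ^ (k + 1) * lnoise v (ρ ^ (k + 1)) g a := by rw [pow_succ' ρ, pow_succ' c, mul_assoc]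

theorem eLpNorm_natCast_succ_eq {X : Type*} [MeasurableSpace X] {μ : Measure X} (f : X → ℝ)
    (N : ℕ) : eLpNorm f (N + 1 : ℕ) μ = (∫⁻ x, ‖f x‖ₑ ^ (N + 1) ∂μ) ^ (1 / (N + 1 : ℕ) : ℝ) := by
  rw [eLpNorm_eq_lintegral_rpow_enorm_toReal (by simp) (by simp)]
  simp only [ENNReal.toReal_natCast, ENNReal.rpow_natCast]

theorem eLpNorm_two_eq {X : Type*} [MeasurableSpace X] {μ : Measure X} (f : X → ℝ) :
    eLpNorm f 2 μ = (∫⁻ x, ‖f x‖ₑ ^ 2 ∂μ) ^ (1 / 2 : ℝ) := by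
  have := eLpNorm_natCast_succ_eq (μ := μ) f 1
  simpa using this

/-- Functions dominated by `c Q g` inherit the hypercontractive bound. -/
theorem eLpNorm_le_of_enorm_le_lnoise (v : ℝ≥0) {N : ℕ} (hN : 0 < N) {ρ : ℝ}
    (hρ : ρ ^ 2 = 1 / N) {c : ℝ≥0∞} {f g : ℝ → ℝ} (hg : Measurable g)
    (h : ∀ᵐ a ∂gaussianReal 0 v, ‖f a‖ₑ ≤ c * lnoise v ρ (fun y => ‖g y‖ₑ) a) :
    eLpNorm f (N + 1 : ℕ) (gaussianReal 0 v) ≤ c * eLpNorm g 2 (gaussianReal 0 v) := by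
  rw [eLpNorm_natCast_succ_eq, eLpNorm_two_eq]
  have h1 : ∫⁻ x, ‖f x‖ₑ ^ (N + 1) ∂gaussianReal 0 v
      ≤ (c * (∫⁻ a, ‖g a‖ₑ ^ 2 ∂gaussianReal 0 v) ^ (1 / 2 : ℝ)) ^ (N + 1) := by
    calc ∫⁻ x, ‖f x‖ₑ ^ (N + 1) ∂gaussianReal 0 v
        ≤ ∫⁻ x, c ^ (N + 1) * lnoise v ρ (fun y => ‖g y‖ₑ) x ^ (N + 1) ∂gaussianReal 0 v := by
          refine lintegral_mono_ae ?_
          filter_upwards [h] with a ha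
          rw [← mul_pow]
          gcongr
      _ = c ^ (N + 1) * ∫⁻ x, lnoise v ρ (fun y => ‖g y‖ₑ) x ^ (N + 1) ∂gaussianReal 0 v :=
          lintegral_const_mul _ ((measurable_lnoise v ρ hg.enorm).pow_const _)
      _ ≤ _ := by
          rw [mul_pow]
          gcongr
          exact lintegral_lnoise_pow_le v hN hρ hg.enorm
  refine (ENNReal.rpow_le_rpow h1 (by positivity)).trans_eq ?_
  rw [← ENNReal.rpow_natCast, ← ENNReal.rpow_mul, mul_one_div_cancel (by positivity),
    ENNReal.rpow_one]

/-! ### Hypercontractivity and symmetry of the Ornstein–Uhlenbeck operator. -/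

namespace OUTree

theorem sqrt_one_sub_exp_neg_two_mul (t : ℝ≥0) :
    Real.sqrt (1 - Real.exp (-(2 * t))) = Real.sqrt (1 - Real.exp (-t) ^ 2) := by
  rw [← Real.exp_nat_mul]
  congr 3
  push_cast
  ring

theorem exp_neg_sq_le_one (t : ℝ≥0) : Real.exp (-(t : ℝ)) ^ 2 ≤ 1 :=
  pow_le_one₀ (Real.exp_pos _).le (Real.exp_le_one_iff.2 (by simp))

theorem enorm_ouFun_le (v t : ℝ≥0) (g : ℝ → ℝ) (a : ℝ) :
    ‖ouFun v t g a‖ₑ ≤ lnoise v (Real.exp (-t)) (fun y => ‖g y‖ₑ) a := by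
  unfold ouFun lnoise
  rw [sqrt_one_sub_exp_neg_two_mul]
  exact enorm_integral_le_lintegral_enorm _

theorem eLpNorm_ouFun_le_of_hypercontractive (v t : ℝ≥0) {N : ℕ} (hN : 0 < N)
    (hρ : Real.exp (-t) ^ 2 = 1 / N) {g : ℝ → ℝ} (hg : AEStronglyMeasurable g (gaussianReal 0 v)) :
    eLpNorm (ouFun v t g) (N + 1 : ℕ) (gaussianReal 0 v) ≤ eLpNorm g 2 (gaussianReal 0 v) := by
  rw [eLpNorm_congr_ae (ouFun_congr v t hg.ae_eq_mk), eLpNorm_congr_ae hg.ae_eq_mk]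
  simpa using eLpNorm_le_of_enorm_le_lnoise v hN hρ (c := 1) hg.stronglyMeasurable_mk.measurable
    (Filter.Eventually.of_forall fun a => by simpa using enorm_ouFun_le v t (hg.mk g) a)

/-- Hölder on `B` between `L²` and `L^{N+1}`, followed by hypercontractivity. The positive power of
the measure of `B`, available once `N > 1`, drives the compactness, the continuity of `λ` and its
decay at `+∞`. -/
theorem eLpNorm_indicator_ouFun_le (v t : ℝ≥0) {N : ℕ} (hN : 0 < N)
    (hρ : Real.exp (-t) ^ 2 = 1 / N) {g : ℝ → ℝ} (hg : MemLp g 2 (gaussianReal 0 v))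
    {B : Set ℝ} (hB : MeasurableSet B) :
    eLpNorm (B.indicator (ouFun v t g)) 2 (gaussianReal 0 v)
      ≤ eLpNorm g 2 (gaussianReal 0 v) * gaussianReal 0 v B ^ (1 / 2 - 1 / (N + 1) : ℝ) := by
  rw [eLpNorm_indicator_eq_eLpNorm_restrict hB]
  have h2 : (2 : ℝ≥0∞) ≤ (N + 1 : ℕ) := by
    have : (2 : ℕ) ≤ N + 1 := by omega
    exact_mod_cast this
  have := eLpNorm_le_eLpNorm_mul_rpow_measure_univ h2 ((memLp_ouFun v t hg).1.restrict (s := B))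
  have hcast : ((N + 1 : ℕ) : ℝ) = N + 1 := by push_cast; rfl
  rw [ENNReal.toReal_natCast, ENNReal.toReal_ofNat, Measure.restrict_apply_univ, hcast] at this
  refine this.trans ?_
  gcongr
  exact (eLpNorm_restrict_le _ _ _ _).trans
    (eLpNorm_ouFun_le_of_hypercontractive v t hN hρ hg.1)

/-- The pair `(X, e^{-t} X + √(1 - e^{-2t}) Y)` is exchangeable. -/
theorem map_pair_swap (v t : ℝ≥0) :
    ((gaussianReal 0 v).prod (gaussianReal 0 v)).map
      (fun p : ℝ × ℝ => (p.1, Real.exp (-t) * p.1 + Real.sqrt (1 - Real.exp (-(2 * t))) * p.2))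
    = ((gaussianReal 0 v).prod (gaussianReal 0 v)).map
      (fun p : ℝ × ℝ => (Real.exp (-t) * p.1 + Real.sqrt (1 - Real.exp (-(2 * t))) * p.2, p.1)) := by
  rw [sqrt_one_sub_exp_neg_two_mul]
  set ρ := Real.exp (-t)
  set s := Real.sqrt (1 - ρ ^ 2)
  have hs : s ^ 2 = 1 - ρ ^ 2 := Real.sq_sqrt (by linarith [exp_neg_sq_le_one t])
  let X : (Fin 2 → ℝ) →L[ℝ] ℝ := ContinuousLinearMap.proj 0
  let Y : (Fin 2 → ℝ) →L[ℝ] ℝ := ρ • ContinuousLinearMap.proj 0 + s • ContinuousLinearMap.proj 1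
  -- Both coordinates have the same variance since `ρ² + s² = 1`, so exchanging them preserves the
  -- covariance.
  have h := map_pi_gaussianReal_eq v (X.prod Y) (Y.prod X) (fun L => by
    have hL : ∀ x y : ℝ, L (x, y) = x * L (1, 0) + y * L (0, 1) := by
      intro x y
      have : ((x, y) : ℝ × ℝ) = x • (1, 0) + y • (0, 1) := by simp
      rw [this, map_add, map_smul, map_smul]
      rfl
    simp only [Fin.sum_univ_two, ContinuousLinearMap.prod_apply]
    have hX0 : X (Pi.single 0 1) = 1 := by simp [X]
    have hX1 : X (Pi.single 1 1) = 0 := by simp [X]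
    have hY0 : Y (Pi.single 0 1) = ρ := by simp [Y]
    have hY1 : Y (Pi.single 1 1) = s := by simp [Y]
    rw [hX0, hX1, hY0, hY1, hL 1 ρ, hL 0 s, hL ρ 1, hL s 0]
    linear_combination ((L (0, 1)) ^ 2 - (L (1, 0)) ^ 2) * hs)
  rw [← (measurePreserving_finTwoArrow (gaussianReal 0 v)).map_eq,
    Measure.map_map (by fun_prop) (MeasurableEquiv.measurable _),
    Measure.map_map (by fun_prop) (MeasurableEquiv.measurable _)]
  exact h

/-- With the bilinear form written over the law of the pair, symmetry of `Q` becomes exchangeability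
of the pair. -/
theorem inner_ouOp_eq_integral (v t : ℝ≥0) (f g : Lp ℝ 2 (gaussianReal 0 v)) :
    inner ℝ (ouOp v t f) g = ∫ p : ℝ × ℝ, g p.1 * f p.2 ∂((gaussianReal 0 v).prod
      (gaussianReal 0 v)).map (fun p : ℝ × ℝ =>
        (p.1, Real.exp (-t) * p.1 + Real.sqrt (1 - Real.exp (-(2 * t))) * p.2)) := by
  have hf := (Lp.memLp f).comp_measurePreserving (measurePreserving_ou v t)
  have hg := (Lp.memLp g).comp_measurePreserving
    (measurePreserving_fst (μ := gaussianReal 0 v) (ν := gaussianReal 0 v))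
  have hm : StronglyMeasurable fun p : ℝ × ℝ => g p.1 * f p.2 :=
    ((Lp.stronglyMeasurable g).comp_measurable measurable_fst).mul
      ((Lp.stronglyMeasurable f).comp_measurable measurable_snd)
  rw [integral_map (by fun_prop) hm.aestronglyMeasurable, L2.inner_def]
  have hint := hg.integrable_mul hf
  refine Eq.trans ?_ (integral_prod _ hint).symm
  refine integral_congr_ae ?_
  have h1 : ouOp v t f =ᵐ[gaussianReal 0 v] ouFun v t f :=
    MemLp.coeFn_toLp (memLp_ouFun v t (Lp.memLp f))
  filter_upwards [h1] with a ha
  simp only [ha, RCLike.inner_apply, conj_trivial]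
  exact (integral_const_mul _ _).symm

theorem isSymmetric_ouOp (v t : ℝ≥0) (f g : Lp ℝ 2 (gaussianReal 0 v)) :
    inner ℝ (ouOp v t f) g = inner ℝ f (ouOp v t g) := by
  have hm : ∀ f g : Lp ℝ 2 (gaussianReal 0 v),
      StronglyMeasurable fun p : ℝ × ℝ => g p.1 * f p.2 := fun f g =>
    ((Lp.stronglyMeasurable g).comp_measurable measurable_fst).mul
      ((Lp.stronglyMeasurable f).comp_measurable measurable_snd)
  rw [← real_inner_comm f, inner_ouOp_eq_integral, inner_ouOp_eq_integral]
  conv_lhs => rw [map_pair_swap v t]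
  rw [integral_map (by fun_prop) (hm f g).aestronglyMeasurable,
    integral_map (by fun_prop) (hm g f).aestronglyMeasurable]
  simp [mul_comm]

end OUTree

/-! ### The Mehler kernel: continuity, positivity and compactness. -/

namespace OUTree

/-- The Mehler kernel, the density of the law of `e^{-t} a + √(1 - e^{-2t}) Y` with respect to that
of `Y`. -/
noncomputable def mehlerKernel (v t : ℝ≥0) (a y : ℝ) : ℝ :=
  (Real.sqrt (1 - Real.exp (-t) ^ 2))⁻¹ *
    Real.exp (a ^ 2 / (2 * v) -
      (Real.exp (-t) * y - a) ^ 2 / (2 * (1 - Real.exp (-t) ^ 2) * v))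

variable {v t : ℝ≥0}

theorem one_sub_exp_neg_sq_pos (ht : t ≠ 0) : 0 < 1 - Real.exp (-(t : ℝ)) ^ 2 := by
  have : Real.exp (-(t : ℝ)) < 1 := Real.exp_lt_one_iff.2 (by
    have : (0 : ℝ) < t := by exact_mod_cast pos_iff_ne_zero.2 ht
    linarith)
  nlinarith [Real.exp_pos (-(t : ℝ))]

theorem mehlerKernel_pos (ht : t ≠ 0) (a y : ℝ) : 0 < mehlerKernel v t a y := by
  have := one_sub_exp_neg_sq_pos ht
  unfold mehlerKernel
  positivity

/-- The bound is uniform in `y` and locally uniform in `a`: it puts the kernel in every `L^p` and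
serves as domination for continuity in `a`. -/
theorem mehlerKernel_le (ht : t ≠ 0) (a y : ℝ) : mehlerKernel v t a y
    ≤ (Real.sqrt (1 - Real.exp (-t) ^ 2))⁻¹ * Real.exp (a ^ 2 / (2 * v)) := by
  have := one_sub_exp_neg_sq_pos ht
  unfold mehlerKernel
  gcongr
  exact sub_le_self _ (by positivity)

theorem continuous_mehlerKernel_left (y : ℝ) : Continuous fun a => mehlerKernel v t a y := by
  unfold mehlerKernel
  fun_prop

theorem continuous_mehlerKernel_right (a : ℝ) : Continuous fun y => mehlerKernel v t a y := by
  unfold mehlerKernel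
  fun_prop

theorem memLp_mehlerKernel (ht : t ≠ 0) (a : ℝ) (p : ℝ≥0∞) :
    MemLp (fun y => mehlerKernel v t a y) p (gaussianReal 0 v) :=
  MemLp.of_bound (continuous_mehlerKernel_right a).aestronglyMeasurable _
    (Filter.Eventually.of_forall fun y => by
      rw [Real.norm_of_nonneg (mehlerKernel_pos ht a y).le]
      exact mehlerKernel_le ht a y)

/-- The kernel is the ratio of two Gaussian densities. The identity holds at every `a`, not just
almost everywhere, which is what permits pointwise conclusions. -/
theorem ouFun_eq_integral_mehlerKernel (hv : v ≠ 0) (ht : t ≠ 0) (g : ℝ → ℝ) (a : ℝ) :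
    ouFun v t g a = ∫ y, mehlerKernel v t a y * g y ∂gaussianReal 0 v := by
  have h1 := one_sub_exp_neg_sq_pos ht
  set ρ := Real.exp (-(t : ℝ)) with hρ
  set s := Real.sqrt (1 - ρ ^ 2) with hs
  have hs0 : 0 < s := Real.sqrt_pos.2 h1
  have hs2 : s ^ 2 = 1 - ρ ^ 2 := Real.sq_sqrt h1.le
  have hv0 : (0 : ℝ) < v := by exact_mod_cast pos_iff_ne_zero.2 hv
  let s2 : ℝ≥0 := ⟨s ^ 2, sq_nonneg s⟩
  have hmap : (gaussianReal 0 v).map (fun y => ρ * a + s * y) = gaussianReal (ρ * a) (s2 * v) := by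
    have : (fun y => ρ * a + s * y) = (fun x => ρ * a + x) ∘ (fun y => s * y) := rfl
    rw [this, ← Measure.map_map (by fun_prop) (by fun_prop), gaussianReal_map_const_mul,
      gaussianReal_map_const_add, mul_zero, zero_add]
    rfl
  have hemb : MeasurableEmbedding fun y => ρ * a + s * y :=
    (measurableEmbedding_addLeft (ρ * a)).comp (measurableEmbedding_mulLeft₀ hs0.ne')
  have hs2v : s2 * v ≠ 0 := mul_ne_zero (fun h => by
    have := congrArg NNReal.toReal h
    exact (pow_pos hs0 2).ne' this) hv
  unfold ouFun
  rw [sqrt_one_sub_exp_neg_two_mul]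
  change ∫ y, g (ρ * a + s * y) ∂gaussianReal 0 v = _
  rw [← hemb.integral_map, hmap, integral_gaussianReal_eq_integral_smul hs2v,
    integral_gaussianReal_eq_integral_smul hv]
  refine integral_congr_ae (Filter.Eventually.of_forall fun y => ?_)
  simp only [smul_eq_mul, gaussianPDFReal, mehlerKernel, ← hρ]
  rw [← hs, ← hs2]
  rw [← mul_assoc]
  congr 1
  have e1 : ((s2 * v : ℝ≥0) : ℝ) = s ^ 2 * v := rfl
  have e2 : Real.sqrt (2 * Real.pi * (s ^ 2 * v)) = s * Real.sqrt (2 * Real.pi * v) := by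
    rw [show 2 * Real.pi * (s ^ 2 * v) = s ^ 2 * (2 * Real.pi * v) by ring,
      Real.sqrt_mul (sq_nonneg s), Real.sqrt_sq hs0.le]
  rw [e1, sub_zero, e2, mul_mul_mul_comm, ← Real.exp_add, mul_inv, mul_comm s⁻¹]
  congr 2
  have hr2 : ρ ^ 2 = 1 - s ^ 2 := by linarith
  field_simp
  linear_combination (-a ^ 2 + y ^ 2) * hr2

theorem continuous_ouFun (hv : v ≠ 0) (ht : t ≠ 0) {g : ℝ → ℝ}
    (hg : Integrable g (gaussianReal 0 v)) : Continuous (ouFun v t g) := by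
  have h : ouFun v t g = fun a => ∫ y, mehlerKernel v t a y * g y ∂gaussianReal 0 v :=
    funext (ouFun_eq_integral_mehlerKernel hv ht g)
  rw [h, continuous_iff_continuousAt]
  intro a
  refine continuousAt_of_dominated (bound := fun y =>
    (Real.sqrt (1 - Real.exp (-t) ^ 2))⁻¹ * Real.exp ((|a| + 1) ^ 2 / (2 * v)) * ‖g y‖) ?_ ?_ ?_ ?_
  · exact Filter.Eventually.of_forall fun x =>
      (continuous_mehlerKernel_right x).aestronglyMeasurable.mul hg.1
  · filter_upwards [Metric.ball_mem_nhds a one_pos] with x hx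
    refine Filter.Eventually.of_forall fun y => ?_
    rw [norm_mul, Real.norm_of_nonneg (mehlerKernel_pos ht x y).le]
    refine mul_le_mul_of_nonneg_right ((mehlerKernel_le ht x y).trans ?_) (norm_nonneg _)
    have hx' : |x| ≤ |a| + 1 := by
      rw [Metric.mem_ball, Real.dist_eq] at hx
      have := abs_sub_abs_le_abs_sub x a
      linarith
    have : x ^ 2 ≤ (|a| + 1) ^ 2 := by
      rw [← sq_abs x]
      exact pow_le_pow_left₀ (abs_nonneg x) hx' 2
    gcongr
  · exact hg.norm.const_mul _
  · exact Filter.Eventually.of_forall fun y =>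
      ((continuous_mehlerKernel_left y).mul continuous_const).continuousAt

theorem integrable_mehlerKernel_mul (ht : t ≠ 0) {g : ℝ → ℝ}
    (hg : Integrable g (gaussianReal 0 v)) (a : ℝ) :
    Integrable (fun y => mehlerKernel v t a y * g y) (gaussianReal 0 v) :=
  hg.bdd_mul (continuous_mehlerKernel_right a).aestronglyMeasurable
    (Filter.Eventually.of_forall fun y => by
      rw [Real.norm_of_nonneg (mehlerKernel_pos ht a y).le]
      exact mehlerKernel_le ht a y)

theorem ouFun_pos (hv : v ≠ 0) (ht : t ≠ 0) {g : ℝ → ℝ}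
    (hg : Integrable g (gaussianReal 0 v)) (h0 : 0 ≤ᵐ[gaussianReal 0 v] g)
    (hne : ¬ g =ᵐ[gaussianReal 0 v] 0) (a : ℝ) : 0 < ouFun v t g a := by
  rw [ouFun_eq_integral_mehlerKernel hv ht]
  have hnn : 0 ≤ᵐ[gaussianReal 0 v] fun y => mehlerKernel v t a y * g y := by
    filter_upwards [h0] with y hy
    exact mul_nonneg (mehlerKernel_pos ht a y).le hy
  rw [integral_pos_iff_support_of_nonneg_ae hnn (integrable_mehlerKernel_mul ht hg a)]
  have hsupp : (Function.support fun y => mehlerKernel v t a y * g y) = Function.support g := by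
    ext y
    simp [(mehlerKernel_pos ht a y).ne']
  rw [hsupp, pos_iff_ne_zero]
  intro h
  exact hne (by rwa [Filter.EventuallyEq, ae_iff])

theorem ouFun_eq_inner (hv : v ≠ 0) (ht : t ≠ 0) (g : Lp ℝ 2 (gaussianReal 0 v)) (a : ℝ) :
    ouFun v t g a = inner ℝ ((memLp_mehlerKernel ht a 2).toLp _) g := by
  rw [ouFun_eq_integral_mehlerKernel hv ht, L2.inner_def]
  refine integral_congr_ae ?_
  filter_upwards [(memLp_mehlerKernel (v := v) ht a 2).coeFn_toLp] with y hy
  rw [hy]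
  simp [mul_comm]

open Filter Topology in
/-- Weak convergence of a bounded sequence is turned into norm convergence. -/
theorem tendsto_ouOp_of_weak (hv : v ≠ 0) (ht : t ≠ 0) {N : ℕ} (hN : 1 < N)
    (hρ : Real.exp (-t) ^ 2 = 1 / N) {f : ℕ → Lp ℝ 2 (gaussianReal 0 v)}
    {g : Lp ℝ 2 (gaussianReal 0 v)} (hb : ∀ n, ‖f n‖ ≤ 1)
    (hw : ∀ u, Tendsto (fun n => inner ℝ u (f n)) atTop (𝓝 (inner ℝ u g))) :
    Tendsto (fun n => ouOp v t (f n)) atTop (𝓝 (ouOp v t g)) := by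
  have hpt : ∀ a, Tendsto (fun n => ouFun v t (f n) a) atTop (𝓝 (ouFun v t g a)) := by
    intro a
    simp_rw [ouFun_eq_inner hv ht]
    exact hw _
  have hui : UnifIntegrable (fun n => ouFun v t (f n)) 2 (gaussianReal 0 v) := by
    have he : (0 : ℝ) < 1 / 2 - 1 / (N + 1) := by
      have : (1 : ℝ) < N := by exact_mod_cast hN
      rw [sub_pos]
      exact one_div_lt_one_div_of_lt (by norm_num) (by linarith)
    intro ε hε
    -- This `δ` solves `δ ^ (1/2 - 1/(N+1)) = ε`.
    refine ⟨ε ^ (1 / 2 - 1 / (N + 1) : ℝ)⁻¹, by positivity, fun n s hs hsm => ?_⟩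
    have hn : eLpNorm (f n) 2 (gaussianReal 0 v) ≤ 1 := by
      have := hb n
      rw [Lp.norm_def] at this
      exact (ENNReal.toReal_le_toReal (Lp.eLpNorm_ne_top _) ENNReal.one_ne_top).1
        (by simpa using this)
    calc eLpNorm (s.indicator (ouFun v t (f n))) 2 (gaussianReal 0 v)
        ≤ eLpNorm (f n) 2 (gaussianReal 0 v) * gaussianReal 0 v s ^ (1 / 2 - 1 / (N + 1) : ℝ) :=
          eLpNorm_indicator_ouFun_le v t (by omega) hρ (Lp.memLp _) hs
      _ ≤ 1 * ENNReal.ofReal (ε ^ (1 / 2 - 1 / (N + 1) : ℝ)⁻¹) ^ (1 / 2 - 1 / (N + 1) : ℝ) := by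
          gcongr
      _ = ENNReal.ofReal ε := by
          rw [one_mul, ENNReal.ofReal_rpow_of_pos (by positivity),
            ← Real.rpow_mul hε.le, inv_mul_cancel₀ he.ne', Real.rpow_one]
  have := tendsto_Lp_finite_of_tendsto_ae one_le_two ENNReal.ofNat_ne_top
    (fun n => (memLp_ouFun v t (Lp.memLp (f n))).1) (memLp_ouFun v t (Lp.memLp g)) hui
    (Eventually.of_forall hpt)
  exact (Lp.tendsto_Lp_iff_tendsto_eLpNorm'' _ (fun n => memLp_ouFun v t (Lp.memLp (f n))) _
    (memLp_ouFun v t (Lp.memLp g))).2 this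

end OUTree

/-! ### Operators attaining their norm on a Hilbert space. -/

section Hilbert

variable {H : Type*} [NormedAddCommGroup H] [InnerProductSpace ℝ H] {T : H →L[ℝ] H}

/-- A vector at which the quadratic form attains its maximal value `‖T‖ ‖f‖²` is an eigenvector. -/
theorem ContinuousLinearMap.apply_eq_norm_smul_of_le_inner {f : H}
    (h : ‖T‖ * ‖f‖ ^ 2 ≤ inner ℝ (T f) f) : T f = ‖T‖ • f := by
  have h1 : ‖T f - ‖T‖ • f‖ ^ 2 ≤ 0 := by
    rw [norm_sub_sq_real, inner_smul_right, norm_smul, norm_norm]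
    have h2 : ‖T f‖ ^ 2 ≤ (‖T‖ * ‖f‖) ^ 2 := by gcongr; exact T.le_opNorm f
    nlinarith [mul_le_mul_of_nonneg_left h (norm_nonneg T)]
  have h2 : ‖T f - ‖T‖ • f‖ = 0 := by
    have := sq_nonneg ‖T f - ‖T‖ • f‖
    exact pow_eq_zero_iff two_ne_zero |>.1 (le_antisymm h1 this)
  exact sub_eq_zero.1 (norm_eq_zero.1 h2)

/-- A vector at which a symmetric operator attains its norm is an eigenvector of its square. -/
theorem ContinuousLinearMap.apply_apply_eq_of_norm_apply_eq
    (hT : ∀ x y, inner ℝ (T x) y = inner ℝ x (T y)) {f : H} (h : ‖T f‖ = ‖T‖ * ‖f‖) :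
    T (T f) = ‖T‖ ^ 2 • f := by
  have h1 : ‖T (T f) - ‖T‖ ^ 2 • f‖ ^ 2 ≤ 0 := by
    rw [norm_sub_sq_real, inner_smul_right, norm_smul, hT, real_inner_self_eq_norm_sq, h,
      norm_pow, norm_norm]
    have h2 : ‖T (T f)‖ ^ 2 ≤ (‖T‖ * (‖T‖ * ‖f‖)) ^ 2 := by
      gcongr
      rw [← h]
      exact T.le_opNorm _
    nlinarith
  have h2 : ‖T (T f) - ‖T‖ ^ 2 • f‖ = 0 :=
    pow_eq_zero_iff two_ne_zero |>.1 (le_antisymm h1 (sq_nonneg _))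
  exact sub_eq_zero.1 (norm_eq_zero.1 h2)

open Filter Topology in
/-- Bounded sequences in a separable Hilbert space have weakly convergent subsequences. -/
theorem exists_subseq_tendsto_inner [CompleteSpace H] [TopologicalSpace.SeparableSpace H]
    {f : ℕ → H} (hf : ∀ n, ‖f n‖ ≤ 1) :
    ∃ g : H, ‖g‖ ≤ 1 ∧ ∃ φ : ℕ → ℕ, StrictMono φ ∧
      ∀ u, Tendsto (fun n => inner ℝ u (f (φ n))) atTop (𝓝 (inner ℝ u g)) := by
  let F : ℕ → WeakDual ℝ H := fun n =>
    StrongDual.toWeakDual (InnerProductSpace.toDual ℝ H (f n))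
  have hF : ∀ n, F n ∈ WeakDual.toStrongDual ⁻¹' Metric.closedBall (0 : StrongDual ℝ H) 1 := by
    intro n
    simp only [Set.mem_preimage, mem_closedBall_zero_iff]
    change ‖InnerProductSpace.toDual ℝ H (f n)‖ ≤ 1
    simpa using hf n
  obtain ⟨L, hL, φ, hφ, hlim⟩ := WeakDual.isSeqCompact_closedBall ℝ H 0 1 hF
  refine ⟨(InnerProductSpace.toDual ℝ H).symm (WeakDual.toStrongDual L), ?_, φ, hφ, fun u => ?_⟩
  · simpa using hL
  · have h1 := ((WeakDual.eval_continuous u).tendsto L).comp hlim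
    have h2 : inner ℝ u ((InnerProductSpace.toDual ℝ H).symm (WeakDual.toStrongDual L)) = L u := by
      rw [real_inner_comm, InnerProductSpace.toDual_symm_apply]
      rfl
    rw [h2]
    refine h1.congr fun n => ?_
    change inner ℝ (f (φ n)) u = _
    exact real_inner_comm _ _

open Filter Topology in
/-- An operator turning weak into norm convergence attains its norm. -/
theorem ContinuousLinearMap.exists_norm_apply_eq [CompleteSpace H]
    [TopologicalSpace.SeparableSpace H] (hT0 : T ≠ 0)
    (hT : ∀ (f : ℕ → H) (g : H), (∀ n, ‖f n‖ ≤ 1) →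
      (∀ u, Tendsto (fun n => inner ℝ u (f n)) atTop (𝓝 (inner ℝ u g))) →
      Tendsto (fun n => T (f n)) atTop (𝓝 (T g))) :
    ∃ f, f ≠ 0 ∧ ‖T f‖ = ‖T‖ * ‖f‖ := by
  have hpos : 0 < ‖T‖ := norm_pos_iff.2 hT0
  have hseq : ∀ n : ℕ, ∃ x : H, ‖x‖ ≤ 1 ∧ ‖T‖ - 1 / ((n : ℝ) + 1) < ‖T x‖ := by
    intro n
    obtain ⟨x, hx, hx'⟩ := T.exists_lt_apply_of_lt_opNorm (r := ‖T‖ - 1 / ((n : ℝ) + 1))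
      (by have : (0 : ℝ) < 1 / ((n : ℝ) + 1) := by positivity
          linarith)
    exact ⟨x, hx.le, hx'⟩
  choose f hf hf' using hseq
  obtain ⟨g, hg, φ, hφ, hw⟩ := exists_subseq_tendsto_inner hf
  have hlim := (hT _ g (fun n => hf (φ n)) hw).norm
  have hge : ‖T‖ ≤ ‖T g‖ := by
    have h1 : Tendsto (fun n => ‖T‖ - 1 / ((φ n : ℝ) + 1)) atTop (𝓝 (‖T‖ - 0)) :=
      tendsto_const_nhds.sub (tendsto_one_div_add_atTop_nhds_zero_nat.comp hφ.tendsto_atTop)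
    rw [sub_zero] at h1
    exact le_of_tendsto_of_tendsto' h1 hlim fun n => (hf' (φ n)).le
  refine ⟨g, fun h => ?_, le_antisymm (T.le_opNorm g) ?_⟩
  · rw [h, map_zero, norm_zero] at hge
    linarith
  · exact (mul_le_of_le_one_right hpos.le hg).trans hge

end Hilbert

/-! ### Perron–Frobenius theory for symmetric operators on `L²`. -/

section PerronFrobenius

variable {X : Type*} [MeasurableSpace X] {μ : Measure X} {T : Lp ℝ 2 μ →L[ℝ] Lp ℝ 2 μ}

theorem inner_nonneg_of_nonneg {f g : Lp ℝ 2 μ} (hf : 0 ≤ f) (hg : 0 ≤ g) : 0 ≤ inner ℝ f g := by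
  rw [L2.inner_def]
  refine integral_nonneg_of_ae ?_
  filter_upwards [(Lp.coeFn_nonneg f).2 hf, (Lp.coeFn_nonneg g).2 hg] with a ha hb
  simpa using mul_nonneg hb ha

theorem Lp_smul_nonneg {c : ℝ} (hc : 0 ≤ c) {f : Lp ℝ 2 μ} (hf : 0 ≤ f) : 0 ≤ c • f := by
  rw [← Lp.coeFn_nonneg] at hf ⊢
  filter_upwards [hf, Lp.coeFn_smul c f] with a ha h
  rw [h]
  exact mul_nonneg hc ha

theorem abs_apply_le_apply_abs (hpos : ∀ f, 0 ≤ f → 0 ≤ T f) (f : Lp ℝ 2 μ) :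
    |T f| ≤ T |f| := by
  refine abs_le'.2 ⟨?_, ?_⟩
  · have := hpos (|f| - f) (sub_nonneg.2 (le_abs_self f))
    rwa [map_sub, sub_nonneg] at this
  · have := hpos (|f| + f) (by rw [← sub_neg_eq_add]; exact sub_nonneg.2 (neg_le_abs f))
    rw [map_add, ← sub_neg_eq_add] at this
    exact sub_nonneg.1 this

/-- A positivity preserving symmetric operator attaining its norm has a nonnegative eigenvector. -/
theorem exists_nonneg_eigenvector (hsymm : ∀ f g, inner ℝ (T f) g = inner ℝ f (T g))
    (hpos : ∀ f, 0 ≤ f → 0 ≤ T f) (hT0 : T ≠ 0)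
    {f : Lp ℝ 2 μ} (hf0 : f ≠ 0) (hf : ‖T f‖ = ‖T‖ * ‖f‖) :
    ∃ g : Lp ℝ 2 μ, 0 ≤ g ∧ ‖g‖ = 1 ∧ T g = ‖T‖ • g := by
  have hN : 0 < ‖T‖ := norm_pos_iff.2 hT0
  have habs : ‖T |f|‖ = ‖T‖ * ‖|f|‖ := by
    refine le_antisymm (T.le_opNorm _) ?_
    rw [norm_abs_eq_norm, ← hf]
    refine norm_le_norm_of_abs_le_abs ((abs_apply_le_apply_abs hpos f).trans (le_abs_self _))
  have h2 := ContinuousLinearMap.apply_apply_eq_of_norm_apply_eq hsymm habs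
  have hTabs : 0 ≤ T |f| := hpos _ (abs_nonneg f)
  have hN' : 0 ≤ ‖T‖ • |f| := Lp_smul_nonneg hN.le (abs_nonneg f)
  -- As `(T - ‖T‖)(T + ‖T‖)|f| = 0`, the vector `(T + ‖T‖)|f|` is a top eigenvector; no cancellation
  -- occurs between its two nonnegative terms.
  have hg0 : T |f| + ‖T‖ • |f| ≠ 0 := by
    intro h
    have h3 : ‖T‖ • |f| = 0 := le_antisymm (by rw [← h]; exact le_add_of_nonneg_left hTabs) hN'
    rcases smul_eq_zero.1 h3 with h4 | h4
    · exact hN.ne' h4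
    · exact hf0 (by rwa [← norm_eq_zero, norm_abs_eq_norm, norm_eq_zero] at h4)
  refine ⟨‖T |f| + ‖T‖ • |f|‖⁻¹ • (T |f| + ‖T‖ • |f|),
    Lp_smul_nonneg (inv_nonneg.2 (norm_nonneg _)) (add_nonneg hTabs hN'), ?_, ?_⟩
  · rw [norm_smul, norm_inv, norm_norm, inv_mul_cancel₀ (norm_ne_zero_iff.2 hg0)]
  · rw [map_smul, smul_comm]
    congr 1
    rw [map_add, map_smul, h2, smul_add, smul_smul, add_comm, pow_two]

/-- Expanding `⟨T(|f| - f), |f| + f⟩ ≥ 0`, the cross terms cancel by symmetry. Hence the quadratic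
form at `|f|` is at least its value at `f`, which is already maximal. -/
theorem apply_abs_eq_of_eigenvector (hsymm : ∀ f g, inner ℝ (T f) g = inner ℝ f (T g))
    (hpos : ∀ f, 0 ≤ f → 0 ≤ T f) {f : Lp ℝ 2 μ} (hf : T f = ‖T‖ • f) : T |f| = ‖T‖ • |f| := by
  refine ContinuousLinearMap.apply_eq_norm_smul_of_le_inner ?_
  have h1 : 0 ≤ inner ℝ (T (|f| - f)) (|f| + f) :=
    inner_nonneg_of_nonneg (hpos _ (sub_nonneg.2 (le_abs_self f)))
      (by rw [← sub_neg_eq_add]; exact sub_nonneg.2 (neg_le_abs f))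
  have h2 : inner ℝ (T f) f = ‖T‖ * ‖f‖ ^ 2 := by
    rw [hf, real_inner_smul_left, real_inner_self_eq_norm_sq]
  have h3 : inner ℝ (T |f|) f = inner ℝ (T f) |f| := by rw [hsymm, real_inner_comm]
  rw [map_sub, inner_sub_left, inner_add_right, inner_add_right, h2, h3] at h1
  rw [norm_abs_eq_norm]
  linarith

variable {S : Set X}

/-- Under positivity improvement, nonzero nonnegative eigenvectors are not orthogonal. -/
theorem inner_ne_zero_of_pos_on (hS : μ S ≠ 0) {f g : Lp ℝ 2 μ} (hf0 : 0 ≤ f) (hg0 : 0 ≤ g)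
    (hf : ∀ᵐ a ∂μ, a ∈ S → 0 < f a) (hg : ∀ᵐ a ∂μ, a ∈ S → 0 < g a) : inner ℝ f g ≠ 0 := by
  intro h
  rw [L2.inner_def, integral_eq_zero_iff_of_nonneg_ae ?_ (L2.integrable_inner f g)] at h
  · apply hS
    rw [measure_eq_zero_iff_ae_notMem]
    filter_upwards [h, hf, hg] with a ha h1 h2 hmem
    simp only [RCLike.inner_apply, conj_trivial, Pi.zero_apply] at ha
    exact (mul_pos (h2 hmem) (h1 hmem)).ne' ha
  · filter_upwards [(Lp.coeFn_nonneg f).2 hf0, (Lp.coeFn_nonneg g).2 hg0] with a ha hb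
    simpa using mul_nonneg hb ha

/-- Top eigenvectors of a positivity improving symmetric operator have constant sign. -/
theorem nonneg_or_nonpos_of_eigenvector (hsymm : ∀ f g, inner ℝ (T f) g = inner ℝ f (T g))
    (hpos : ∀ f, 0 ≤ f → 0 ≤ T f) (hS : μ S ≠ 0)
    (himp : ∀ g : Lp ℝ 2 μ, 0 ≤ g → g ≠ 0 → T g = ‖T‖ • g → ∀ᵐ a ∂μ, a ∈ S → 0 < g a)
    {f : Lp ℝ 2 μ} (hf : T f = ‖T‖ • f) : 0 ≤ f ∨ f ≤ 0 := by
  by_contra! hcon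
  have habs := apply_abs_eq_of_eigenvector hsymm hpos hf
  have h1 : 0 ≤ |f| + f := by rw [← sub_neg_eq_add]; exact sub_nonneg.2 (neg_le_abs f)
  have h2 : 0 ≤ |f| - f := sub_nonneg.2 (le_abs_self f)
  have h1ne : |f| + f ≠ 0 := fun h => hcon.2 (by
    rw [← neg_nonneg, ← eq_neg_of_add_eq_zero_left h]; exact abs_nonneg f)
  have h2ne : |f| - f ≠ 0 := fun h => hcon.1 (by rw [← sub_eq_zero.1 h]; exact abs_nonneg f)
  -- Both `|f| + f` and `|f| - f` are nonzero nonnegative eigenvectors, hence positive on `S`,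
  -- although their product `|f|² - f²` vanishes.
  have h3 := himp _ h1 h1ne (by rw [map_add, habs, hf, smul_add])
  have h4 := himp _ h2 h2ne (by rw [map_sub, habs, hf, smul_sub])
  apply hS
  rw [measure_eq_zero_iff_ae_notMem]
  filter_upwards [h3, h4, Lp.coeFn_add |f| f, Lp.coeFn_sub |f| f, Lp.coeFn_abs f]
    with a h3 h4 e1 e2 e3 hmem
  have h3 := h3 hmem
  have h4 := h4 hmem
  rw [e1, Pi.add_apply, e3] at h3
  rw [e2, Pi.sub_apply, e3] at h4
  have := mul_pos h3 h4
  nlinarith [sq_abs (f a)]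

/-- **Simplicity of the top eigenvalue** of a positivity improving symmetric operator. -/
theorem eigenvector_eq_smul (hsymm : ∀ f g, inner ℝ (T f) g = inner ℝ f (T g))
    (hpos : ∀ f, 0 ≤ f → 0 ≤ T f) (hS : μ S ≠ 0)
    (himp : ∀ g : Lp ℝ 2 μ, 0 ≤ g → g ≠ 0 → T g = ‖T‖ • g → ∀ᵐ a ∂μ, a ∈ S → 0 < g a)
    {χ f : Lp ℝ 2 μ} (hχ0 : 0 ≤ χ) (hχ1 : ‖χ‖ = 1) (hχ : T χ = ‖T‖ • χ) (hf : T f = ‖T‖ • f) :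
    f = inner ℝ χ f • χ := by
  set c : ℝ := inner ℝ χ f with hc
  have hχne : χ ≠ 0 := fun h => by simp [h] at hχ1
  have hψ : T (f - c • χ) = ‖T‖ • (f - c • χ) := by
    rw [map_sub, map_smul, hf, hχ, smul_sub, smul_comm]
  have horth : inner ℝ χ (f - c • χ) = 0 := by
    rw [inner_sub_right, inner_smul_right, real_inner_self_eq_norm_sq, hχ1, ← hc]
    ring
  by_contra hne
  have hne' : f - c • χ ≠ 0 := sub_ne_zero.2 hne
  rcases nonneg_or_nonpos_of_eigenvector hsymm hpos hS himp hψ with h | h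
  · exact inner_ne_zero_of_pos_on hS hχ0 h (himp _ hχ0 hχne hχ) (himp _ h hne' hψ) horth
  · have h' : 0 ≤ -(f - c • χ) := neg_nonneg.2 h
    refine inner_ne_zero_of_pos_on hS hχ0 h' (himp _ hχ0 hχne hχ)
      (himp _ h' (neg_ne_zero.2 hne') (by rw [map_neg, hψ, smul_neg])) ?_
    rw [inner_neg_right, horth, neg_zero]

theorem nonneg_eigenvector_unique (hsymm : ∀ f g, inner ℝ (T f) g = inner ℝ f (T g))
    (hpos : ∀ f, 0 ≤ f → 0 ≤ T f) (hS : μ S ≠ 0)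
    (himp : ∀ g : Lp ℝ 2 μ, 0 ≤ g → g ≠ 0 → T g = ‖T‖ • g → ∀ᵐ a ∂μ, a ∈ S → 0 < g a)
    {χ f : Lp ℝ 2 μ} (hχ0 : 0 ≤ χ) (hχ1 : ‖χ‖ = 1) (hχ : T χ = ‖T‖ • χ)
    (hf0 : 0 ≤ f) (hf1 : ‖f‖ = 1) (hf : T f = ‖T‖ • f) : f = χ := by
  have h := eigenvector_eq_smul hsymm hpos hS himp hχ0 hχ1 hχ hf
  have hc : 0 ≤ inner ℝ χ f := inner_nonneg_of_nonneg hχ0 hf0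
  have hn := congrArg norm h
  rw [norm_smul, hχ1, hf1, mul_one, Real.norm_of_nonneg hc] at hn
  rw [h, ← hn, one_smul]

theorem finrank_eigenspace_eq_one (hsymm : ∀ f g, inner ℝ (T f) g = inner ℝ f (T g))
    (hpos : ∀ f, 0 ≤ f → 0 ≤ T f) (hS : μ S ≠ 0)
    (himp : ∀ g : Lp ℝ 2 μ, 0 ≤ g → g ≠ 0 → T g = ‖T‖ • g → ∀ᵐ a ∂μ, a ∈ S → 0 < g a)
    {χ : Lp ℝ 2 μ} (hχ0 : 0 ≤ χ) (hχ1 : ‖χ‖ = 1) (hχ : T χ = ‖T‖ • χ) :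
    Module.finrank ℝ (Module.End.eigenspace (T : Module.End ℝ (Lp ℝ 2 μ)) ‖T‖) = 1 := by
  have hχne : χ ≠ 0 := fun h => by simp [h] at hχ1
  have hmem : χ ∈ Module.End.eigenspace (T : Module.End ℝ (Lp ℝ 2 μ)) ‖T‖ :=
    Module.End.mem_eigenspace_iff.2 hχ
  refine finrank_eq_one (⟨χ, hmem⟩ : Module.End.eigenspace _ _)
    (fun h => hχne (congrArg Subtype.val h)) fun w => ⟨inner ℝ χ (w : Lp ℝ 2 μ), ?_⟩
  exact Subtype.ext (eigenvector_eq_smul hsymm hpos hS himp hχ0 hχ1 hχ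
    (Module.End.mem_eigenspace_iff.1 w.2)).symm

end PerronFrobenius

/-! ### Cutoffs, and their products with `Q`. -/

namespace OUTree

section Cutoff

variable {μ : Measure ℝ}

theorem coeFn_cutoff (h : ℝ) (f : Lp ℝ 2 μ) : cutoff μ h f =ᵐ[μ] (Set.Ici h).indicator f := by
  have h1 : cutoff μ h f = ((Lp.memLp f).indicator (measurableSet_Ici (a := h))).toLp _ := rfl
  rw [h1]
  exact MemLp.coeFn_toLp _

theorem isSymmetric_cutoff (h : ℝ) (f g : Lp ℝ 2 μ) :
    inner ℝ (cutoff μ h f) g = inner ℝ f (cutoff μ h g) := by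
  rw [L2.inner_def, L2.inner_def]
  refine integral_congr_ae ?_
  filter_upwards [coeFn_cutoff h f, coeFn_cutoff h g] with a h1 h2
  simp only [h1, h2, RCLike.inner_apply, conj_trivial, Set.indicator_apply]
  split_ifs <;> simp

theorem cutoff_nonneg (h : ℝ) {f : Lp ℝ 2 μ} (hf : 0 ≤ f) : 0 ≤ cutoff μ h f := by
  rw [← Lp.coeFn_nonneg] at hf ⊢
  filter_upwards [hf, coeFn_cutoff h f] with a ha h1
  rw [h1]
  rw [Set.indicator_apply]
  split_ifs
  exacts [ha, le_rfl]

theorem norm_cutoff_le (h : ℝ) : ‖cutoff μ h‖ ≤ 1 := LinearMap.mkContinuous_norm_le _ zero_le_one _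

theorem cutoff_eq_self {h : ℝ} {f : Lp ℝ 2 μ} (hf : ∀ᵐ a ∂μ, a < h → f a = 0) :
    cutoff μ h f = f := by
  refine Lp.ext ?_
  filter_upwards [coeFn_cutoff h f, hf] with a h1 h2
  rw [h1, Set.indicator_apply]
  split_ifs with hm
  · rfl
  · exact (h2 (not_le.1 hm)).symm

end Cutoff

section OrnsteinUhlenbeck

variable {v t : ℝ≥0}

theorem coeFn_ouOp (v t : ℝ≥0) (f : Lp ℝ 2 (gaussianReal 0 v)) :
    ouOp v t f =ᵐ[gaussianReal 0 v] ouFun v t f :=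
  MemLp.coeFn_toLp (memLp_ouFun v t (Lp.memLp f))

theorem norm_ouOp_le (v t : ℝ≥0) : ‖ouOp v t‖ ≤ 1 :=
  LinearMap.mkContinuous_norm_le _ zero_le_one _

theorem ouOp_nonneg (v t : ℝ≥0) {f : Lp ℝ 2 (gaussianReal 0 v)} (hf : 0 ≤ f) :
    0 ≤ ouOp v t f := by
  have hφ := Measure.ae_ae_of_ae_prod
    ((measurePreserving_ou v t).quasiMeasurePreserving.ae ((Lp.coeFn_nonneg f).2 hf))
  rw [← Lp.coeFn_nonneg]
  filter_upwards [coeFn_ouOp v t f, hφ] with a h1 h2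
  rw [h1]
  exact integral_nonneg_of_ae h2

/-- A multiplication operator supported on `B`, composed with `Q`, is small if `B` is. -/
theorem norm_comp_ouOp_le {N : ℕ} (hN : 0 < N) (hρ : Real.exp (-t) ^ 2 = 1 / N)
    {R : Lp ℝ 2 (gaussianReal 0 v) →L[ℝ] Lp ℝ 2 (gaussianReal 0 v)} {B : Set ℝ}
    (hB : MeasurableSet B)
    (hR : ∀ u : Lp ℝ 2 (gaussianReal 0 v),
      ∀ᵐ a ∂gaussianReal 0 v, ‖R u a‖ ≤ ‖B.indicator u a‖) :
    ‖R ∘L ouOp v t‖ ≤ (gaussianReal 0 v B ^ (1 / 2 - 1 / (N + 1) : ℝ)).toReal := by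
  have he : (0 : ℝ) ≤ 1 / 2 - 1 / (N + 1) := by
    have : (1 : ℝ) ≤ N := by exact_mod_cast hN
    rw [sub_nonneg]
    exact one_div_le_one_div_of_le (by norm_num) (by linarith)
  refine ContinuousLinearMap.opNorm_le_bound _ ENNReal.toReal_nonneg fun f => ?_
  rw [mul_comm, Lp.norm_def, Lp.norm_def, ← ENNReal.toReal_mul]
  refine ENNReal.toReal_mono (ENNReal.mul_ne_top (Lp.eLpNorm_ne_top _)
    (ENNReal.rpow_ne_top_of_nonneg he (measure_ne_top _ _))) ?_
  refine (eLpNorm_mono_ae ?_).trans (eLpNorm_indicator_ouFun_le v t hN hρ (Lp.memLp f) hB)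
  filter_upwards [hR (ouOp v t f), coeFn_ouOp v t f] with a h1 h2
  rw [ContinuousLinearMap.comp_apply]
  by_cases hm : a ∈ B
  · rw [Set.indicator_of_mem hm, h2] at h1
    rwa [Set.indicator_of_mem hm]
  · rwa [Set.indicator_of_notMem hm] at h1 ⊢

/-- The two products are adjoint to each other. -/
theorem norm_comp_comm_of_symmetric {H : Type*} [NormedAddCommGroup H] [InnerProductSpace ℝ H]
    [CompleteSpace H] {A B : H →L[ℝ] H} (hA : ∀ x y, inner ℝ (A x) y = inner ℝ x (A y))
    (hB : ∀ x y, inner ℝ (B x) y = inner ℝ x (B y)) : ‖A ∘L B‖ = ‖B ∘L A‖ := by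
  have hA' : ContinuousLinearMap.adjoint A = A :=
    ((ContinuousLinearMap.eq_adjoint_iff A A).2 hA).symm
  have hB' : ContinuousLinearMap.adjoint B = B :=
    ((ContinuousLinearMap.eq_adjoint_iff B B).2 hB).symm
  rw [← LinearIsometryEquiv.norm_map ContinuousLinearMap.adjoint (A ∘L B),
    ContinuousLinearMap.adjoint_comp, hA', hB']

end OrnsteinUhlenbeck

section Parameters

/-- The time `log d`. -/
noncomputable abbrev logTime (d : ℕ) : ℝ≥0 := ⟨Real.log d, Real.log_natCast_nonneg d⟩

variable {d : ℕ}

theorem sigmaSq_ne_zero (hd : 2 ≤ d) : sigmaSq d ≠ 0 := by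
  have hd' : (2 : ℝ) ≤ d := by exact_mod_cast hd
  unfold sigmaSq
  rw [ne_eq, Real.toNNReal_eq_zero, not_le]
  have : (0 : ℝ) < (d : ℝ) ^ 2 - 1 := by nlinarith
  positivity

theorem logTime_ne_zero (hd : 2 ≤ d) : logTime d ≠ 0 := fun h => by
  have h1 : Real.log d = 0 := congrArg NNReal.toReal h
  have hd' : (2 : ℝ) ≤ d := by exact_mod_cast hd
  exact (Real.log_pos (by linarith)).ne' h1

theorem exp_neg_logTime (hd : 2 ≤ d) : Real.exp (-(logTime d : ℝ)) = (d : ℝ)⁻¹ := by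
  change Real.exp (-Real.log d) = _
  rw [Real.exp_neg, Real.exp_log (by positivity)]

theorem exp_neg_logTime_sq (hd : 2 ≤ d) :
    Real.exp (-(logTime d : ℝ)) ^ 2 = 1 / ((d ^ 2 : ℕ) : ℝ) := by
  rw [exp_neg_logTime hd]
  push_cast
  simp

theorem one_lt_sq (hd : 2 ≤ d) : 1 < d ^ 2 := by nlinarith

end Parameters

/-! ### The operator `L_h`: positivity and existence of a top eigenvector. -/

section Operator

variable {d : ℕ} {h : ℝ}

theorem Lop_apply (f : Lp ℝ 2 (nu d)) :
    Lop d h f = (d : ℝ) • cutoff (nu d) h (ouOp (sigmaSq d) (logTime d) (cutoff (nu d) h f)) := by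
  rw [← map_smul]
  rfl

theorem Lop_eq : Lop d h
    = (d : ℝ) • (cutoff (nu d) h ∘L ouOp (sigmaSq d) (logTime d) ∘L cutoff (nu d) h) := by
  ext1 f
  exact Lop_apply f

theorem coeFn_Lop (f : Lp ℝ 2 (nu d)) : Lop d h f =ᵐ[nu d] (Set.Ici h).indicator
    fun a => d * ouFun (sigmaSq d) (logTime d) (cutoff (nu d) h f) a := by
  rw [Lop_apply]
  filter_upwards [Lp.coeFn_smul (d : ℝ)
      (cutoff (nu d) h (ouOp (sigmaSq d) (logTime d) (cutoff (nu d) h f))),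
    coeFn_cutoff h (ouOp (sigmaSq d) (logTime d) (cutoff (nu d) h f)),
    coeFn_ouOp (sigmaSq d) (logTime d) (cutoff (nu d) h f)] with a h1 h2 h3
  rw [h1, Pi.smul_apply, h2, Set.indicator_apply, Set.indicator_apply, h3]
  split_ifs <;> simp

theorem isSymmetric_Lop (f g : Lp ℝ 2 (nu d)) :
    inner ℝ (Lop d h f) g = inner ℝ f (Lop d h g) := by
  rw [Lop_apply, Lop_apply, real_inner_smul_left, real_inner_smul_right, isSymmetric_cutoff,
    isSymmetric_ouOp, isSymmetric_cutoff]

theorem Lop_nonneg {f : Lp ℝ 2 (nu d)} (hf : 0 ≤ f) : 0 ≤ Lop d h f := by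
  rw [Lop_apply]
  exact Lp_smul_nonneg (Nat.cast_nonneg d) (cutoff_nonneg h (ouOp_nonneg _ _ (cutoff_nonneg h hf)))

theorem lam_le (d : ℕ) (h : ℝ) : lam d h ≤ d := by
  unfold lam
  rw [Lop_eq, norm_smul, Real.norm_natCast]
  refine mul_le_of_le_one_right (Nat.cast_nonneg d) ?_
  refine (ContinuousLinearMap.opNorm_comp_le _ _).trans (mul_le_one₀ (norm_cutoff_le h)
    (norm_nonneg _) ?_)
  exact (ContinuousLinearMap.opNorm_comp_le _ _).trans (mul_le_one₀ (norm_ouOp_le _ _)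
    (norm_nonneg _) (norm_cutoff_le h))

theorem nu_ne_zero_of_volume (hd : 2 ≤ d) {S : Set ℝ} (hS : volume S ≠ 0) : nu d S ≠ 0 :=
  fun h0 => hS (gaussianReal_absolutelyContinuous' 0 (sigmaSq_ne_zero hd) h0)

theorem nu_Ici_ne_zero (hd : 2 ≤ d) (h : ℝ) : nu d (Set.Ici h) ≠ 0 :=
  nu_ne_zero_of_volume hd (by simp)

theorem ouFun_coeFn_pos (hd : 2 ≤ d) {f : Lp ℝ 2 (nu d)} (h0 : 0 ≤ f) (hne : f ≠ 0) (a : ℝ) :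
    0 < ouFun (sigmaSq d) (logTime d) f a :=
  ouFun_pos (sigmaSq_ne_zero hd) (logTime_ne_zero hd) ((Lp.memLp f).integrable (by norm_num))
    ((Lp.coeFn_nonneg f).2 h0) (fun h => hne ((Lp.eq_zero_iff_ae_eq_zero).2 h)) a

/-- `L_h` is positivity improving on `[h, ∞)`. -/
theorem Lop_pos_on (hd : 2 ≤ d) {f : Lp ℝ 2 (nu d)} (h0 : 0 ≤ f)
    (hne : cutoff (nu d) h f ≠ 0) : ∀ᵐ a ∂nu d, a ∈ Set.Ici h → 0 < Lop d h f a := by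
  filter_upwards [coeFn_Lop (h := h) f] with a h1 ha
  rw [h1, Set.indicator_of_mem ha]
  exact mul_pos (by positivity) (ouFun_coeFn_pos hd (cutoff_nonneg h h0) hne a)

theorem Lop_ne_zero (hd : 2 ≤ d) (h : ℝ) : Lop d h ≠ 0 := by
  intro h0
  let u : Lp ℝ 2 (nu d) := Lp.const 2 (nu d) 1
  have hu : u =ᵐ[nu d] fun _ => (1 : ℝ) := Lp.coeFn_const (p := 2) (μ := nu d) (1 : ℝ)
  have hu0 : 0 ≤ u := by
    rw [← Lp.coeFn_nonneg]
    filter_upwards [hu] with a ha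
    rw [ha]
    exact zero_le_one
  have hne : cutoff (nu d) h u ≠ 0 := by
    intro h1
    apply nu_Ici_ne_zero hd h
    rw [measure_eq_zero_iff_ae_notMem]
    filter_upwards [hu, coeFn_cutoff h u, Lp.eq_zero_iff_ae_eq_zero.1 h1] with a h2 h3 h4 hmem
    rw [h3, Set.indicator_of_mem hmem, h2] at h4
    exact one_ne_zero h4
  apply nu_Ici_ne_zero hd h
  rw [measure_eq_zero_iff_ae_notMem]
  have h5 : Lop d h u = 0 := by rw [h0]; rfl
  filter_upwards [Lop_pos_on hd hu0 hne, Lp.eq_zero_iff_ae_eq_zero.1 h5] with a h6 h7 hmem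
  exact (h6 hmem).ne' h7

theorem lam_pos (hd : 2 ≤ d) (h : ℝ) : 0 < lam d h := norm_pos_iff.2 (Lop_ne_zero hd h)

theorem ae_eq_zero_of_eigenvector (hd : 2 ≤ d) {g : Lp ℝ 2 (nu d)}
    (hg : Lop d h g = lam d h • g) : ∀ᵐ a ∂nu d, a < h → g a = 0 := by
  have h1 := coeFn_Lop (h := h) g
  rw [hg] at h1
  filter_upwards [h1, Lp.coeFn_smul (lam d h) g] with a h2 h3 ha
  rw [h3, Set.indicator_of_notMem (Set.notMem_Ici.2 ha)] at h2
  exact (mul_eq_zero.1 h2).resolve_left (lam_pos hd h).ne'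

theorem cutoff_eigenvector (hd : 2 ≤ d) {g : Lp ℝ 2 (nu d)}
    (hg : Lop d h g = lam d h • g) : cutoff (nu d) h g = g :=
  cutoff_eq_self (ae_eq_zero_of_eigenvector hd hg)

theorem eigenvector_pos_on (hd : 2 ≤ d) (g : Lp ℝ 2 (nu d)) (h0 : 0 ≤ g) (hne : g ≠ 0)
    (hg : Lop d h g = lam d h • g) : ∀ᵐ a ∂nu d, a ∈ Set.Ici h → 0 < g a := by
  have h1 := Lop_pos_on (h := h) hd h0 (by rwa [cutoff_eigenvector hd hg])
  rw [hg] at h1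
  filter_upwards [h1, Lp.coeFn_smul (lam d h) g] with a h2 h3 ha
  have h4 := h2 ha
  rw [h3] at h4
  exact pos_of_mul_pos_right h4 (lam_pos hd h).le

-- The cutoff is bounded and symmetric, so it preserves weak convergence. Thus `L_h` inherits from
-- `Q`, with `N = d²`, the property of turning weak into norm convergence, and it attains its norm.
open Filter Topology in
theorem exists_unit_eigenvector (hd : 2 ≤ d) (h : ℝ) :
    ∃ g : Lp ℝ 2 (nu d), 0 ≤ g ∧ ‖g‖ = 1 ∧ Lop d h g = lam d h • g := by
  have : Fact ((2 : ℝ≥0∞) ≠ ∞) := ⟨ENNReal.ofNat_ne_top⟩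
  obtain ⟨f, hf0, hf⟩ := ContinuousLinearMap.exists_norm_apply_eq (Lop_ne_zero hd h) (by
    intro f g hb hw
    simp_rw [Lop_apply]
    refine Tendsto.const_smul ?_ _
    refine ((cutoff (nu d) h).continuous.tendsto _).comp ?_
    refine tendsto_ouOp_of_weak (sigmaSq_ne_zero hd) (logTime_ne_zero hd) (one_lt_sq hd)
      (exp_neg_logTime_sq hd) (fun n => ?_) fun u => ?_
    · exact ((cutoff (nu d) h).le_opNorm _).trans
        (mul_le_one₀ (norm_cutoff_le h) (norm_nonneg _) (hb n))
    · simp_rw [← isSymmetric_cutoff]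
      exact hw _)
  exact exists_nonneg_eigenvector isSymmetric_Lop (fun _ => Lop_nonneg) (Lop_ne_zero hd h) hf0 hf

end Operator

end OUTree

/-! ### The principal eigenfunction and its norms. -/

namespace OUTree

variable {d : ℕ} {h : ℝ}

theorem finrank_eigenspace_Lop (hd : 2 ≤ d) (h : ℝ) : Module.finrank ℝ
    (Module.End.eigenspace (Lop d h : Module.End ℝ (Lp ℝ 2 (nu d))) (lam d h)) = 1 := by
  obtain ⟨g, h0, h1, hg⟩ := exists_unit_eigenvector hd h
  exact finrank_eigenspace_eq_one isSymmetric_Lop (fun _ => Lop_nonneg) (nu_Ici_ne_zero hd h)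
    (eigenvector_pos_on hd) h0 h1 hg

theorem hasEigenvalue_Lop (hd : 2 ≤ d) (h : ℝ) :
    Module.End.HasEigenvalue (Lop d h : Module.End ℝ (Lp ℝ 2 (nu d))) (lam d h) := by
  obtain ⟨g, -, h1, hg⟩ := exists_unit_eigenvector hd h
  exact Module.End.hasEigenvalue_of_hasEigenvector
    ⟨Module.End.mem_eigenspace_iff.2 hg, fun h0 => by simp [h0] at h1⟩

theorem norm_toLp_eq_one {χ : ℝ → ℝ} (hχ : IsPrincipalEigenfunction d h χ)
    (hm : MemLp χ 2 (nu d)) : ‖hm.toLp χ‖ = 1 := by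
  rw [Lp.norm_toLp, hχ.norm_eq_one, ENNReal.toReal_one]

theorem toLp_nonneg {χ : ℝ → ℝ} (hχ : IsPrincipalEigenfunction d h χ)
    (hm : MemLp χ 2 (nu d)) : 0 ≤ hm.toLp χ := by
  rw [← Lp.coeFn_nonneg]
  filter_upwards [hm.coeFn_toLp] with a ha
  rw [ha]
  exact hχ.nonneg a

/-- The `L²` classes agree by simplicity. Lebesgue measure is absolutely continuous with respect to
`ν`, so continuity upgrades equality almost everywhere to equality on `[h, ∞)`. -/
theorem IsPrincipalEigenfunction.unique (hd : 2 ≤ d) {χ χ' : ℝ → ℝ}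
    (hχ : IsPrincipalEigenfunction d h χ) (hχ' : IsPrincipalEigenfunction d h χ') : χ = χ' := by
  obtain ⟨hm, he⟩ := hχ.eigen
  obtain ⟨hm', he'⟩ := hχ'.eigen
  have heq : hm.toLp χ = hm'.toLp χ' :=
    nonneg_eigenvector_unique isSymmetric_Lop (fun _ => Lop_nonneg) (nu_Ici_ne_zero hd h)
      (eigenvector_pos_on hd) (toLp_nonneg hχ' hm') (norm_toLp_eq_one hχ' hm') he'
      (toLp_nonneg hχ hm) (norm_toLp_eq_one hχ hm) he
  have hae : χ =ᵐ[nu d] χ' := (MemLp.toLp_eq_toLp_iff hm hm').1 heq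
  have hvol : χ =ᵐ[volume] χ' :=
    (gaussianReal_absolutelyContinuous' 0 (sigmaSq_ne_zero hd)).ae_le hae
  have hon := Measure.eqOn_of_ae_eq (ae_restrict_of_ae hvol) hχ.continuousOn hχ'.continuousOn
    (by rw [interior_Ici, closure_Ioi])
  ext a
  rcases lt_or_ge a h with ha | ha
  · rw [hχ.eq_zero a ha, hχ'.eq_zero a ha]
  · exact hon ha

theorem exists_isPrincipalEigenfunction (hd : 2 ≤ d) (h : ℝ) :
    ∃ χ, IsPrincipalEigenfunction d h χ := by
  obtain ⟨g, h0, h1, hg⟩ := exists_unit_eigenvector hd h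
  have hgne : g ≠ 0 := fun h0 => by simp [h0] at h1
  have hlam := lam_pos hd h
  have hd0 : (0 : ℝ) < d := by positivity
  -- The eigenvalue equation solved for `g`: since `Q g` is continuous and positive everywhere, this
  -- representative of `g` is too on `[h, ∞)`.
  set χ : ℝ → ℝ := (Set.Ici h).indicator
    fun a => (lam d h)⁻¹ * (d * ouFun (sigmaSq d) (logTime d) g a) with hχ
  have hpos : ∀ a, h ≤ a → 0 < χ a := fun a ha => by
    rw [hχ, Set.indicator_of_mem (Set.mem_Ici.2 ha)]
    exact mul_pos (inv_pos.2 hlam) (mul_pos hd0 (ouFun_coeFn_pos hd h0 hgne a))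
  have hzero : ∀ a, a < h → χ a = 0 := fun a ha =>
    Set.indicator_of_notMem (Set.notMem_Ici.2 ha) _
  have hae : χ =ᵐ[nu d] g := by
    have h2 := coeFn_Lop (h := h) g
    rw [hg, cutoff_eigenvector hd hg] at h2
    filter_upwards [h2, Lp.coeFn_smul (lam d h) g] with a h3 h4
    rw [h4, Pi.smul_apply, smul_eq_mul] at h3
    rw [eq_inv_mul_iff_mul_eq₀ hlam.ne' |>.2 h3, hχ, Set.indicator_apply, Set.indicator_apply]
    split_ifs <;> simp
  have hm : MemLp χ 2 (nu d) := (Lp.memLp g).ae_eq hae.symm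
  have hlp : hm.toLp χ = g := by
    refine Lp.ext ?_
    exact hm.coeFn_toLp.trans hae
  refine ⟨χ, ⟨fun a => ?_, ?_, hpos, hzero, ?_, hm, ?_⟩⟩
  · rcases lt_or_ge a h with ha | ha
    · exact (hzero a ha).ge
    · exact (hpos a ha).le
  · refine ContinuousOn.congr (f := fun a =>
      (lam d h)⁻¹ * (d * ouFun (sigmaSq d) (logTime d) g a)) ?_ fun a ha => Set.indicator_of_mem ha _
    have := continuous_ouFun (sigmaSq_ne_zero hd) (logTime_ne_zero hd)
      ((Lp.memLp g).integrable (by norm_num))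
    fun_prop
  · rw [eLpNorm_congr_ae hae, ← ENNReal.toReal_eq_one_iff, ← Lp.norm_def, h1]
  · rw [hlp, hg]

theorem IsPrincipalEigenfunction.measurable {χ : ℝ → ℝ} (hχ : IsPrincipalEigenfunction d h χ) :
    Measurable χ := by
  classical
  have h1 : χ = (Set.Ici h).piecewise χ 0 := by
    ext a
    rcases lt_or_ge a h with ha | ha
    · rw [Set.piecewise_eq_of_notMem _ _ _ (Set.notMem_Ici.2 ha), hχ.eq_zero a ha, Pi.zero_apply]
    · rw [Set.piecewise_eq_of_mem _ _ _ (Set.mem_Ici.2 ha)]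
  rw [h1]
  exact hχ.continuousOn.measurable_piecewise continuousOn_const measurableSet_Ici

/-- Dropping the outer cutoff in the eigenvalue equation makes `χ` a subsolution for `Q`, which can
be iterated. -/
theorem IsPrincipalEigenfunction.enorm_le_lnoise (hd : 2 ≤ d) {χ : ℝ → ℝ}
    (hχ : IsPrincipalEigenfunction d h χ) :
    (fun a => ‖χ a‖ₑ) ≤ᵐ[nu d] fun a => ENNReal.ofReal (d / lam d h) *
      lnoise (sigmaSq d) (d : ℝ)⁻¹ (fun y => ‖χ y‖ₑ) a := by
  obtain ⟨hm, he⟩ := hχ.eigen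
  have hlam := lam_pos hd h
  have h2 := coeFn_Lop (h := h) (hm.toLp χ)
  rw [cutoff_eigenvector hd he, he] at h2
  filter_upwards [h2, Lp.coeFn_smul (lam d h) (hm.toLp χ), hm.coeFn_toLp,
    ouFun_congr (sigmaSq d) (logTime d) hm.coeFn_toLp] with a h3 h4 h5 h6
  rw [h4, Pi.smul_apply, smul_eq_mul, h5] at h3
  have h7 : ‖χ a‖ₑ ≤ ENNReal.ofReal (d / lam d h) * ‖ouFun (sigmaSq d) (logTime d) χ a‖ₑ := by
    rw [eq_inv_mul_iff_mul_eq₀ hlam.ne' |>.2 h3, Set.indicator_apply]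
    split_ifs with hm
    · rw [h6, ← mul_assoc, enorm_mul, inv_mul_eq_div,
        Real.enorm_of_nonneg (div_nonneg (Nat.cast_nonneg d) hlam.le)]
    · simp
  refine h7.trans ?_
  gcongr
  have h8 := enorm_ouFun_le (sigmaSq d) (logTime d) χ a
  rwa [exp_neg_logTime hd] at h8

theorem IsPrincipalEigenfunction.eLpNorm_le (hd : 2 ≤ d) {χ : ℝ → ℝ}
    (hχ : IsPrincipalEigenfunction d h χ) (k : ℕ) :
    eLpNorm χ (1 + (d : ℝ≥0∞) ^ (2 * k)) (nu d) ≤ ENNReal.ofReal (((d : ℝ) / lam d h) ^ k) := by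
  have hd' : (2 : ℝ) ≤ d := by exact_mod_cast hd
  have hρ : ((d : ℝ)⁻¹) ^ 2 ≤ 1 :=
    pow_le_one₀ (by positivity) (inv_le_one_of_one_le₀ (by linarith))
  have h1 := ae_le_lnoise_pow (sigmaSq d) hρ ENNReal.ofReal_ne_top hχ.measurable.enorm
    (hχ.enorm_le_lnoise hd) k
  have h2 := eLpNorm_le_of_enorm_le_lnoise (sigmaSq d) (N := d ^ (2 * k)) (by positivity)
    (ρ := (d : ℝ)⁻¹ ^ k) (by push_cast; rw [← pow_mul, mul_comm k, inv_pow, one_div])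
    hχ.measurable h1
  rw [hχ.norm_eq_one, mul_one] at h2
  rw [ENNReal.ofReal_pow (div_nonneg (Nat.cast_nonneg d) (lam_pos hd h).le), add_comm]
  exact_mod_cast h2

/-! ### The map `h ↦ λ_h`: monotonicity, continuity and limits. -/

/-- If `λ_h ≤ λ_{h'}` with `h < h'`, the eigenvector for `h'` maximizes the quadratic form of `L_h`,
so it is also an eigenvector of `L_h`. It would then be positive on `[h, h')`, where it vanishes. -/
theorem strictAnti_lam (hd : 2 ≤ d) : StrictAnti (lam d) := by
  intro h h' hlt
  by_contra! hle
  obtain ⟨g, h0, h1, hg⟩ := exists_unit_eigenvector hd h'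
  have hgne : g ≠ 0 := fun h0 => by simp [h0] at h1
  have hz := ae_eq_zero_of_eigenvector hd hg
  have hcut : cutoff (nu d) h g = g :=
    cutoff_eq_self (by filter_upwards [hz] with a ha h1 using ha (h1.trans hlt))
  have hinner : inner ℝ (Lop d h g) g = inner ℝ (Lop d h' g) g := by
    rw [Lop_apply, Lop_apply, real_inner_smul_left, real_inner_smul_left, isSymmetric_cutoff,
      isSymmetric_cutoff, hcut, cutoff_eigenvector hd hg]
  have heig : Lop d h g = lam d h • g := by
    refine ContinuousLinearMap.apply_eq_norm_smul_of_le_inner ?_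
    rw [hinner, hg, real_inner_smul_left, real_inner_self_eq_norm_sq]
    exact mul_le_mul_of_nonneg_right hle (sq_nonneg _)
  have hIco : nu d (Set.Ico h h') ≠ 0 :=
    nu_ne_zero_of_volume hd (by simpa using hlt)
  apply hIco
  rw [measure_eq_zero_iff_ae_notMem]
  filter_upwards [hz, eigenvector_pos_on hd g h0 hgne heig] with a h2 h3 hmem
  exact (h3 hmem.1).ne' (h2 hmem.2)

/-- Strictness comes from comparison with the threshold `h - 1`. -/
theorem lam_lt (hd : 2 ≤ d) (h : ℝ) : lam d h < d :=
  (strictAnti_lam hd (sub_one_lt h)).trans_le (lam_le d _)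

/-- The Hölder exponent `1 / 2 - 1 / (1 + d²)` given by hypercontractivity. -/
noncomputable abbrev hoelderExp (d : ℕ) : ℝ := 1 / 2 - 1 / (((d ^ 2 : ℕ) : ℝ) + 1)

theorem hoelderExp_pos (hd : 2 ≤ d) : 0 < hoelderExp d := by
  have : (1 : ℝ) < ((d ^ 2 : ℕ) : ℝ) := by exact_mod_cast one_lt_sq hd
  unfold hoelderExp
  rw [sub_pos]
  exact one_div_lt_one_div_of_lt (by norm_num) (by linarith)

open Filter Topology in
theorem tendsto_toReal_rpow_zero {ι : Type*} {l : Filter ι} {u : ι → ℝ≥0∞} {e : ℝ} (he : 0 < e)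
    (hu : Tendsto u l (𝓝 0)) : Tendsto (fun i => (u i ^ e).toReal) l (𝓝 0) := by
  have h1 : Tendsto (fun i => u i ^ e) l (𝓝 (0 ^ e)) := (ENNReal.continuous_rpow_const.tendsto 0).comp hu
  rw [ENNReal.zero_rpow_of_pos he] at h1
  exact (ENNReal.tendsto_toReal ENNReal.zero_ne_top).comp h1

theorem abs_lam_sub_le (hd : 2 ≤ d) (h h' : ℝ) : |lam d h' - lam d h| ≤
    d * (2 * (nu d (Set.Icc (h - |h' - h|) (h + |h' - h|)) ^ hoelderExp d).toReal) := by
  set Q := ouOp (sigmaSq d) (logTime d)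
  set P := cutoff (nu d) h
  set P' := cutoff (nu d) h'
  have hD : ‖(P' - P) ∘L Q‖
      ≤ (nu d (Set.Icc (h - |h' - h|) (h + |h' - h|)) ^ hoelderExp d).toReal := by
    refine norm_comp_ouOp_le (by positivity) (exp_neg_logTime_sq hd) measurableSet_Icc fun u => ?_
    filter_upwards [coeFn_cutoff h u, coeFn_cutoff h' u, Lp.coeFn_sub (P' u) (P u)] with a h1 h2 h3
    rw [sub_apply, h3, Pi.sub_apply, h1, h2]
    simp only [Set.indicator_apply, Set.mem_Ici, Set.mem_Icc]
    -- Where the two cutoffs differ, the point lies between `h` and `h'`; the symmetric interval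
    -- covers both orders.
    split_ifs <;> simp <;> refine absurd ?_ ‹¬ (_ ∧ _)› <;> constructor <;>
      cases abs_cases (h' - h) <;> linarith
  have hsD : ∀ x y, inner ℝ ((P' - P) x) y = inner ℝ x ((P' - P) y) := fun x y => by
    rw [sub_apply, sub_apply, inner_sub_left, inner_sub_right, isSymmetric_cutoff,
      isSymmetric_cutoff]
  have hD' : ‖Q ∘L (P' - P)‖
      ≤ (nu d (Set.Icc (h - |h' - h|) (h + |h' - h|)) ^ hoelderExp d).toReal := by
    rwa [norm_comp_comm_of_symmetric (isSymmetric_ouOp _ _) hsD]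
  -- Changing one cutoff at a time leaves `P' - P` next to `Q` in each term.
  have hdecomp : Lop d h' - Lop d h
      = (d : ℝ) • (((P' - P) ∘L Q) ∘L P' + P ∘L (Q ∘L (P' - P))) := by
    rw [Lop_eq, Lop_eq, ← smul_sub]
    congr 1
    ext1 f
    simp [P, P', Q]
  refine (abs_norm_sub_norm_le _ _).trans ?_
  rw [hdecomp, norm_smul, Real.norm_natCast, two_mul]
  gcongr
  refine (norm_add_le _ _).trans (add_le_add ?_ ?_)
  · exact (ContinuousLinearMap.opNorm_comp_le _ _).trans
      ((mul_le_of_le_one_right (norm_nonneg _) (norm_cutoff_le h')).trans hD)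
  · exact (ContinuousLinearMap.opNorm_comp_le _ _).trans
      ((mul_le_of_le_one_left (norm_nonneg _) (norm_cutoff_le h)).trans hD')

open Filter Topology in
theorem continuous_lam (hd : 2 ≤ d) : Continuous (lam d) := by
  have := nullSingletonClass_gaussianReal (μ := 0) (sigmaSq_ne_zero hd)
  rw [continuous_iff_continuousAt]
  intro h
  rw [ContinuousAt, tendsto_iff_norm_sub_tendsto_zero]
  have h1 : Tendsto (fun h' : ℝ => |h' - h|) (𝓝 h) (𝓝 0) := by
    have : Continuous fun h' : ℝ => |h' - h| := by fun_prop
    simpa using this.tendsto h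
  have h2 := tendsto_toReal_rpow_zero (hoelderExp_pos hd)
    ((tendsto_measure_Icc (nu d) h).comp h1)
  have h3 := (h2.const_mul 2).const_mul (d : ℝ)
  rw [mul_zero, mul_zero] at h3
  exact squeeze_zero (fun _ => norm_nonneg _) (fun h' => abs_lam_sub_le hd h h') h3

open Filter Topology in
theorem tendsto_lam_atTop (hd : 2 ≤ d) : Tendsto (lam d) atTop (𝓝 0) := by
  have hmeas : Tendsto (fun h : ℝ => nu d (Set.Ici h)) atTop (𝓝 0) := by
    have h1 := tendsto_measure_iInter_atTop (μ := nu d) (s := fun h : ℝ => Set.Ici h)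
      (fun _ => measurableSet_Ici.nullMeasurableSet) (fun _ _ hab => Set.Ici_subset_Ici.2 hab)
      ⟨0, measure_ne_top _ _⟩
    have h2 : ⋂ n : ℝ, Set.Ici n = ∅ := by
      ext a
      simpa using exists_gt a
    rwa [h2, measure_empty] at h1
  have h3 := (tendsto_toReal_rpow_zero (hoelderExp_pos hd) hmeas).const_mul (d : ℝ)
  rw [mul_zero] at h3
  refine squeeze_zero (fun h => (lam_pos hd h).le) (fun h => ?_) h3
  unfold lam
  rw [Lop_eq, norm_smul, Real.norm_natCast, ← ContinuousLinearMap.comp_assoc]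
  gcongr
  refine (ContinuousLinearMap.opNorm_comp_le _ _).trans
    ((mul_le_of_le_one_right (norm_nonneg _) (norm_cutoff_le h)).trans ?_)
  refine norm_comp_ouOp_le (by positivity) (exp_neg_logTime_sq hd) measurableSet_Ici fun u => ?_
  filter_upwards [coeFn_cutoff h u] with a h1
  rw [h1]

/-- The constant function one. -/
noncomputable abbrev oneLp (d : ℕ) : Lp ℝ 2 (nu d) := Lp.const 2 (nu d) 1

theorem ouOp_oneLp (d : ℕ) (t : ℝ≥0) : ouOp (sigmaSq d) t (oneLp d) = oneLp d := by
  have hu : oneLp d =ᵐ[nu d] fun _ => (1 : ℝ) := Lp.coeFn_const (p := 2) (μ := nu d) (1 : ℝ)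
  refine Lp.ext ?_
  filter_upwards [coeFn_ouOp (sigmaSq d) t (oneLp d), ouFun_congr (sigmaSq d) t hu, hu]
    with a h1 h2 h3
  rw [h1, h2, h3]
  simp [ouFun]

theorem norm_oneLp (d : ℕ) : ‖oneLp d‖ = 1 := by
  rw [Lp.norm_const _ _ _ two_ne_zero]
  simp

theorem norm_cutoff_oneLp_sub (d : ℕ) (h : ℝ) : ‖cutoff (nu d) h (oneLp d) - oneLp d‖
    = (nu d (Set.Iio h) ^ (1 / 2 : ℝ)).toReal := by
  have hu : oneLp d =ᵐ[nu d] fun _ => (1 : ℝ) := Lp.coeFn_const (p := 2) (μ := nu d) (1 : ℝ)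
  have h1 : cutoff (nu d) h (oneLp d) - oneLp d =ᵐ[nu d]
      (Set.Iio h).indicator fun _ => (-1 : ℝ) := by
    filter_upwards [Lp.coeFn_sub (cutoff (nu d) h (oneLp d)) (oneLp d),
      coeFn_cutoff h (oneLp d), hu] with a h1 h2 h3
    rw [h1, Pi.sub_apply, h2, h3]
    rcases lt_or_ge a h with ha | ha
    · rw [Set.indicator_of_notMem (Set.notMem_Ici.2 ha), Set.indicator_of_mem (Set.mem_Iio.2 ha)]
      norm_num
    · rw [Set.indicator_of_mem (Set.mem_Ici.2 ha),
        Set.indicator_of_notMem (Set.notMem_Iio.2 ha), h3, sub_self]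
  rw [Lp.norm_def, eLpNorm_congr_ae h1, eLpNorm_indicator_const measurableSet_Iio (by norm_num)
    (by norm_num)]
  simp

/-- The constant function is fixed by `Q`, so `L_h` moves it away from its multiple by `d` only
through the mass cut off, once for each cutoff. -/
theorem le_lam (d : ℕ) (h : ℝ) :
    d - d * (2 * (nu d (Set.Iio h) ^ (1 / 2 : ℝ)).toReal) ≤ lam d h := by
  set Q := ouOp (sigmaSq d) (logTime d)
  set P := cutoff (nu d) h
  set u := oneLp d
  have h1 : ‖Lop d h u‖ ≤ lam d h := by
    have := (Lop d h).le_opNorm u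
    rwa [norm_oneLp, mul_one] at this
  have h2 : (d : ℝ) • u - Lop d h u = (d : ℝ) • -((P ∘L Q) (P u - u) + (P u - u)) := by
    rw [Lop_apply, ← smul_sub]
    congr 1
    rw [map_sub, ContinuousLinearMap.comp_apply, ContinuousLinearMap.comp_apply,
      show Q u = u from ouOp_oneLp d _]
    abel
  have hPQ : ‖P ∘L Q‖ ≤ 1 := (ContinuousLinearMap.opNorm_comp_le _ _).trans
    (mul_le_one₀ (norm_cutoff_le h) (norm_nonneg _) (norm_ouOp_le _ _))
  have h3 : ‖(d : ℝ) • u - Lop d h u‖ ≤ d * (2 * ‖P u - u‖) := by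
    rw [h2, norm_smul, Real.norm_natCast, norm_neg, two_mul]
    gcongr
    refine (norm_add_le _ _).trans (add_le_add_left ?_ _)
    exact ((P ∘L Q).le_opNorm _).trans (mul_le_of_le_one_left (norm_nonneg _) hPQ)
  have h4 : ‖(d : ℝ) • u‖ = d := by
    rw [norm_smul, Real.norm_natCast, norm_oneLp, mul_one]
  have h5 := norm_sub_norm_le ((d : ℝ) • u) (Lop d h u)
  rw [← norm_cutoff_oneLp_sub]
  linarith

open Filter Topology in
theorem tendsto_lam_atBot (d : ℕ) : Tendsto (lam d) atBot (𝓝 d) := by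
  have hmeas : Tendsto (fun h : ℝ => nu d (Set.Iio h)) atBot (𝓝 0) := by
    have h1 := tendsto_measure_iInter_atBot (μ := nu d) (s := fun h : ℝ => Set.Iio h)
      (fun _ => measurableSet_Iio.nullMeasurableSet) (fun _ _ hab => Set.Iio_subset_Iio hab)
      ⟨0, measure_ne_top _ _⟩
    have h2 : ⋂ n : ℝ, Set.Iio n = ∅ := by
      ext a
      simpa using ⟨a, le_rfl⟩
    rwa [h2, measure_empty] at h1
  have h3 := (((tendsto_toReal_rpow_zero (e := 1 / 2) (by norm_num) hmeas).const_mul 2).const_mul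
    (d : ℝ)).const_sub (d : ℝ)
  rw [mul_zero, mul_zero, sub_zero] at h3
  exact tendsto_of_tendsto_of_tendsto_of_le_of_le h3 tendsto_const_nhds (le_lam d) (lam_le d)

open Filter Topology in
theorem exists_lam_eq (hd : 2 ≤ d) {y : ℝ} (hy0 : 0 < y) (hyd : y < d) : ∃ h, lam d h = y := by
  obtain ⟨a, ha⟩ := ((tendsto_lam_atTop hd).eventually_le_const hy0).exists
  obtain ⟨b, hb⟩ := ((tendsto_lam_atBot d).eventually_const_le hyd).exists
  exact mem_range_of_exists_le_of_exists_ge (continuous_lam hd) ⟨a, ha⟩ ⟨b, hb⟩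

theorem exists_homeomorph_lam (hd : 2 ≤ d) :
    ∃ e : ℝ ≃ₜ Set.Ioo (0 : ℝ) d, ∀ h : ℝ, (e h : ℝ) = lam d h := by
  -- The sign change makes the map increasing: an increasing surjection is an order isomorphism,
  -- hence a homeomorphism for the order topologies.
  let f : ℝ → Set.Ioo (0 : ℝ) d := fun h => ⟨lam d (-h), lam_pos hd _, lam_lt hd _⟩
  have hf : StrictMono f := fun a b hab => strictAnti_lam hd (neg_lt_neg hab)
  have hsurj : Function.Surjective f := fun y => by
    obtain ⟨h, hh⟩ := exists_lam_eq hd y.2.1 y.2.2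
    exact ⟨-h, Subtype.ext (by simpa [f] using hh)⟩
  refine ⟨(Homeomorph.neg ℝ).trans (hf.orderIsoOfSurjective f hsurj).toHomeomorph, fun h => ?_⟩
  simp [f]

end OUTree

open OUTree in
theorem proposition3p1 (d : ℕ) (hd : 2 ≤ d) :
    (∀ h : ℝ,
      Module.End.HasEigenvalue (Lop d h : Module.End ℝ (Lp ℝ 2 (nu d))) (lam d h) ∧
      Module.finrank ℝ
        (Module.End.eigenspace (Lop d h : Module.End ℝ (Lp ℝ 2 (nu d))) (lam d h)) = 1 ∧
      (∃! χ : ℝ → ℝ, IsPrincipalEigenfunction d h χ) ∧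
      (∀ χ : ℝ → ℝ, IsPrincipalEigenfunction d h χ → ∀ k : ℕ,
        eLpNorm χ (1 + (d : ℝ≥0∞) ^ (2 * k)) (nu d)
          ≤ ENNReal.ofReal (((d : ℝ) / lam d h) ^ k))) ∧
    StrictAnti (lam d) ∧
    (∃ e : ℝ ≃ₜ Set.Ioo (0 : ℝ) d, ∀ h : ℝ, (e h : ℝ) = lam d h) := by
  refine ⟨fun h => ⟨hasEigenvalue_Lop hd h, finrank_eigenspace_Lop hd h, ?_,
    fun χ hχ k => hχ.eLpNorm_le hd k⟩, strictAnti_lam hd, exists_homeomorph_lam hd⟩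
  obtain ⟨χ, hχ⟩ := exists_isPrincipalEigenfunction hd h
  exact ⟨χ, hχ, fun χ' hχ' => hχ'.unique hd hχ⟩
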